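/- Let $G$ be a locally compact groupoid (possibly non-Hausdorff: multiplication and inversion are continuous, the unit space $G^0$ and the fibres $G^u=r^{-1}(u)$ are locally compact Hausdorff, and the interiors of the members of some countable family of compact Hausdorff subsets of $G$ form a basis of the topology), with range and domain maps $r(x)=xx^{-1}$, $d(x)=x^{-1}x$ and a left Haar system $\lambda=\{\lambda^u\}_{u\in G^0}$. Let $\mu$ be a quasi-invariant probability measure on $G^0$, i.e. $\nu=\int\lambda^u\,d\mu(u)$ and its image $\nu^{-1}$ under inversion are equivalent, and put $d\nu_0=(d\nu/d\nu^{-1})^{-1/2}\,d\nu$. Suppose $\mu$ is ergodic: every measurable $A\subseteq G^0$ such that $r(x)\in A\Leftrightarrow d(x)\in A$ for $\nu$-a.e. $x\in G$ is $\mu$-null or $\mu$-conull. Let $L$ be an (a.e.) representation of $G$ on a Hilbert bundle (measurable field of Hilbert spaces with a fundamental sequence) $\mathcal H=(G^0,\{H_u\},\mu)$: $L(x):H_{d(x)}\to H_{r(x)}$ is unitary for $\nu$-a.e. $x$ in the reduction of $G$ to some $\mu$-conull set, $L(u)$ is the identity for $\mu$-a.e. $u\in G^0$, $L(x)L(y)=L(xy)$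 for $\nu^2$-a.e. composable pair $(x,y)$, where $\nu^2=\int\lambda_u\times\lambda^u\,d\mu(u)$ and $\lambda_u$ is the image of $\lambda^u$ under inversion, $L(x)^{-1}=L(x^{-1})$ for $\nu$-a.e. $x$, and $x\mapsto\langle L(x)\xi(d(x)),\eta(r(x))\rangle$ is $\nu$-measurable for all $\xi,\eta\in\mathcal H(\mu)=L^2(G^0,\{H_u\},\mu)$. Let $\pi_L$ be the representation on $\mathcal H(\mu)$, given by $$\langle\pi_L(f)\xi,\eta\rangle=\int_G f(x)\,\langle L(x)\xi(d(x)),\eta(r(x))\rangle\,d\nu_0(x)\qquad(f\in C_c(G)),$$ of the C*-algebra $C^*(G)$, the completion of $C_c(G)$ in the norm $\|f\|=\sup_{L'}\|\pi_{L'}(f)\|$ over all representations $L'$ of $G$. Here $C_c(G)$ is the linear span of the functions on $G$ that are continuous with compact support on some open Hausdorff subset and zero outside it. A Hilbert subbundle $\mathcal M=(G^0,\{M_u\},\mu)$ of $\mathcal H$ is called nontrivial invariant if $L(x)M_{d(x)}\subseteq M_{r(x)}$ for $\nu$-a.e. $x$, $\mu\{u:M_u\ne0\}>0$ and $\mu\{u:M_u\neq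 H_u\}>0$. The representation $L$ is reducible if it has a nontrivial invariant Hilbert subbundle, $\pi_L$ is reducible if $\mathcal H(\mu)$ has a $\pi_L$-invariant closed subspace other than $0$ and $\mathcal H(\mu)$, and irreducible means not reducible. Then: 1. for every nontrivial invariant Hilbert subbundle $\mathcal M$ for $L$, the space $\mathcal M(\mu)=\{\xi\in\mathcal H(\mu):\xi(u)\in M_u\text{ for }\mu\text{-a.e. }u\}$ is a $\pi_L$-invariant closed subspace of $\mathcal H(\mu)$, different from $0$ and from $\mathcal H(\mu)$; 2. if $L$ is reducible, then $\pi_L$ is reducible; 3. $L$ is irreducible if and only if $\pi_L$ is irreducible. -/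

import Mathlib

open MeasureTheory Topology

universe u v

namespace LCGroupoid

/-! ### Locally compact groupoids -/

/-- An (algebraic) groupoid given by its set `G` of arrows: a set `comp` of composable pairs, a
product and an inverse map. The product is a total function whose values off `comp` are
irrelevant: no axiom and no definition below refers to them. -/
class AlgGroupoid (G : Type u) where
  comp : Set (G × G)
  mul : G → G → G
  inv : G → G
  inv_inv : ∀ x, inv (inv x) = x
  comp_left : ∀ {x y z}, (x, y) ∈ comp → (y, z) ∈ comp → (mul x y, z) ∈ comp
  comp_right : ∀ {x y z}, (x, y) ∈ comp → (y, z) ∈ comp → (x, mul y z) ∈ comp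
  mul_assoc : ∀ {x y z}, (x, y) ∈ comp → (y, z) ∈ comp → mul (mul x y) z = mul x (mul y z)
  inv_comp : ∀ x, (inv x, x) ∈ comp
  inv_mul_cancel_left : ∀ {x y}, (x, y) ∈ comp → mul (inv x) (mul x y) = y
  mul_inv_cancel_right : ∀ {x y}, (x, y) ∈ comp → mul (mul x y) (inv y) = x


/-- The unit space `G⁰ = {x x⁻¹}`, with the topology and Borel structure induced from `G`. -/
abbrev G0 (G : Type u) [AlgGroupoid G] : Type u :=
  {a : G // ∃ x : G, AlgGroupoid.mul x (AlgGroupoid.inv x) = a}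

section Alg

variable {G : Type u} [AlgGroupoid G]

/-- The range map `r(x) = x x⁻¹`. -/
def r (x : G) : G0 G := ⟨AlgGroupoid.mul x (AlgGroupoid.inv x), x, rfl⟩

/-- The domain map `d(x) = x⁻¹ x`. -/
def d (x : G) : G0 G :=
  ⟨AlgGroupoid.mul (AlgGroupoid.inv x) x, AlgGroupoid.inv x, by rw [AlgGroupoid.inv_inv]⟩

/-- The fibre `Gᵃ = r⁻¹(a)`. -/
abbrev RFiber (a : G0 G) : Type u := {x : G // r x = a}

theorem r_inv (x : G) : r (AlgGroupoid.inv x) = d x :=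
  Subtype.ext (by simp only [r, d, AlgGroupoid.inv_inv])

theorem d_inv (x : G) : d (AlgGroupoid.inv x) = r x :=
  Subtype.ext (by simp only [r, d, AlgGroupoid.inv_inv])

theorem comp_inv (x : G) : (x, AlgGroupoid.inv x) ∈ AlgGroupoid.comp (G := G) := by
  have h := AlgGroupoid.inv_comp (AlgGroupoid.inv x)
  rwa [AlgGroupoid.inv_inv] at h

theorem d_eq_r {x y : G} (h : (x, y) ∈ AlgGroupoid.comp (G := G)) : d x = r y := by
  have h1 : (AlgGroupoid.mul (AlgGroupoid.inv x) x, y) ∈ AlgGroupoid.comp (G := G) :=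
    AlgGroupoid.comp_left (AlgGroupoid.inv_comp x) h
  have h2 : AlgGroupoid.mul (AlgGroupoid.mul (AlgGroupoid.inv x) x) y = y := by
    rw [AlgGroupoid.mul_assoc (AlgGroupoid.inv_comp x) h, AlgGroupoid.inv_mul_cancel_left h]
  have h3 := AlgGroupoid.mul_inv_cancel_right h1
  rw [h2] at h3
  exact Subtype.ext h3.symm

theorem r_mul {x y : G} (h : (x, y) ∈ AlgGroupoid.comp (G := G)) :
    r (AlgGroupoid.mul x y) = r x := by
  rw [← d_eq_r (AlgGroupoid.comp_right (AlgGroupoid.inv_comp x) h), d_inv]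

theorem d_mul {x y : G} (h : (x, y) ∈ AlgGroupoid.comp (G := G)) :
    d (AlgGroupoid.mul x y) = d y := by
  rw [d_eq_r (AlgGroupoid.comp_left h (comp_inv y)), r_inv]

theorem r_unit (a : G0 G) : r a.1 = a := by
  obtain ⟨_, x, rfl⟩ := a
  exact r_mul (comp_inv x)

theorem d_unit (a : G0 G) : d a.1 = a := by
  obtain ⟨_, x, rfl⟩ := a
  exact (d_mul (comp_inv x)).trans (d_inv x)

end Alg

/-- A locally compact groupoid (not necessarily Hausdorff): product and inverse are continuous, the
unit space and the fibres `Gᵃ` are locally compact Hausdorff, and the interiors of the members of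
some countable family of compact Hausdorff subsets form a basis of the topology. -/
class LocallyCompactGroupoid (G : Type u) [TopologicalSpace G] extends AlgGroupoid G where
  continuousOn_mul : ContinuousOn (fun p : G × G => mul p.1 p.2) comp
  continuous_inv : Continuous inv
  t2_units : T2Space (G0 G)
  locallyCompact_units : LocallyCompactSpace (G0 G)
  basis : ∃ C : Set (Set G), C.Countable ∧ (∀ K ∈ C, IsCompact K ∧ T2Space K) ∧
    TopologicalSpace.IsTopologicalBasis (interior '' C)
  t2_fiber : ∀ a : G0 G, T2Space (RFiber a)
  locallyCompact_fiber : ∀ a : G0 G, LocallyCompactSpace (RFiber a)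

/-- The space `C_c(G)`: the linear span of the functions that are continuous with compact support
on some open Hausdorff subset `V` of `G` and vanish outside `V`. When `G` is Hausdorff these are
the continuous functions with compact support (see `mem_Cc_iff`). -/
def Cc (G : Type u) [TopologicalSpace G] : Submodule ℂ (G → ℂ) :=
  Submodule.span ℂ {f | ∃ V : Set G, IsOpen V ∧ T2Space V ∧ ContinuousOn f V ∧
    ∃ K ⊆ V, IsCompact K ∧ ∀ x ∉ K, f x = 0}

theorem mem_Cc_iff {G : Type u} [TopologicalSpace G] [T2Space G] {f : G → ℂ} :
    f ∈ Cc G ↔ Continuous f ∧ HasCompactSupport f := by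
  constructor
  · intro hf
    induction hf using Submodule.span_induction with
    | mem f hf =>
      obtain ⟨V, hV, -, hfV, K, hKV, hK, h0⟩ := hf
      refine ⟨continuous_iff_continuousAt.2 fun x => ?_, HasCompactSupport.intro hK h0⟩
      by_cases hx : x ∈ V
      · exact hfV.continuousAt (hV.mem_nhds hx)
      · have hxK : Kᶜ ∈ 𝓝 x := hK.isClosed.isOpen_compl.mem_nhds fun h => hx (hKV h)
        have : f =ᶠ[𝓝 x] fun _ => (0 : ℂ) := by
          filter_upwards [hxK] with y hy using h0 y hy
        exact continuousAt_const.congr this.symm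
    | zero => exact ⟨continuous_const, HasCompactSupport.zero⟩
    | add f g _ _ hf hg => exact ⟨hf.1.add hg.1, hf.2.add hg.2⟩
    | smul c f _ hf => exact ⟨hf.1.const_smul c, hf.2.smul_left (f := fun _ => c)⟩
  · rintro ⟨hc, hs⟩
    exact Submodule.subset_span ⟨Set.univ, isOpen_univ, inferInstance, hc.continuousOn,
      tsupport f, Set.subset_univ _, hs, fun x hx => image_eq_zero_of_notMem_tsupport hx⟩

/-- A left Haar system: regular Borel measures `λᵃ` on the fibres `Gᵃ`, with full support,
depending continuously on `a`, and left invariant. -/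
structure HaarSystem (G : Type u) [TopologicalSpace G] [MeasurableSpace G]
    [LocallyCompactGroupoid G] where
  measure : ∀ a : G0 G, Measure (RFiber a)
  regular : ∀ a, (measure a).Regular
  full_support : ∀ a, (measure a).IsOpenPosMeasure
  continuous_integral : ∀ f ∈ Cc G, Continuous (fun a => ∫ z, f z.1 ∂(measure a)) ∧
    HasCompactSupport (fun a => ∫ z, f z.1 ∂(measure a))
  left_invariant : ∀ f ∈ Cc G, ∀ x : G,
    ∫ z, f (AlgGroupoid.mul (AlgGroupoid.inv x) z.1) ∂(measure (r x)) =
      ∫ y, f y.1 ∂(measure (d x))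

namespace HaarSystem

variable {G : Type u} [TopologicalSpace G] [MeasurableSpace G] [LocallyCompactGroupoid G]
  (hs : HaarSystem G) (μ : Measure (G0 G))

/-- `λᵃ` as a measure on `G`. -/
noncomputable def lam (a : G0 G) : Measure G := (hs.measure a).map Subtype.val

/-- `λ_a`, the image of `λᵃ` under inversion, as a measure on `G`. -/
noncomputable def lamInv (a : G0 G) : Measure G := (hs.lam a).map AlgGroupoid.inv

/-- `ν = ∫ λᵃ dμ(a)`. -/
noncomputable def nu : Measure G := μ.bind hs.lam

/-- `ν⁻¹(E) = ν(E⁻¹)`. -/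
noncomputable def nuInv : Measure G := (hs.nu μ).map AlgGroupoid.inv

/-- `ν² = ∫ λ_a × λᵃ dμ(a)`, a measure on pairs that is carried by the composable ones. -/
noncomputable def nu2 : Measure (G × G) := μ.bind fun a => (hs.lamInv a).prod (hs.lam a)

/-- Quasi-invariance: `ν ∼ ν⁻¹`. -/
def QuasiInvariant : Prop := hs.nu μ ≪ hs.nuInv μ ∧ hs.nuInv μ ≪ hs.nu μ

/-- The modular function `δ = dν/dν⁻¹`. -/
noncomputable def modular : G → ENNReal := (hs.nu μ).rnDeriv (hs.nuInv μ)

/-- `dν₀ = δ^(-1/2) dν`. -/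
noncomputable def nu0 : Measure G :=
  (hs.nu μ).withDensity fun x => (hs.modular μ x) ^ (-(1 / 2) : ℝ)

/-- `A ⊆ G⁰` is almost invariant. -/
def AlmostInvariant (A : Set (G0 G)) : Prop := ∀ᵐ x ∂(hs.nu μ), r x ∈ A ↔ d x ∈ A

/-- Ergodicity: almost invariant measurable sets are null or conull. -/
def Ergodic : Prop := ∀ A : Set (G0 G), MeasurableSet A → hs.AlmostInvariant μ A →
  μ A = 0 ∨ μ Aᶜ = 0

end HaarSystem

/-! ### Hilbert bundles and their square integrable sections -/

/-- A measurable field of Hilbert spaces over `(X, μ)`. Measurability of scalar functions is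
`μ`-measurability, i.e. `AEMeasurable`. -/
structure HilbertBundle (X : Type u) [MeasurableSpace X] (μ : Measure X) where
  Fiber : X → Type v
  [normed : ∀ a, NormedAddCommGroup (Fiber a)]
  [inner : ∀ a, InnerProductSpace ℂ (Fiber a)]
  [complete : ∀ a, CompleteSpace (Fiber a)]
  /-- The measurable sections. -/
  meas : Submodule ℂ (∀ a, Fiber a)
  norm_meas : ∀ ξ ∈ meas, AEMeasurable (fun a => ‖ξ a‖) μ
  mem_meas : ∀ η : ∀ a, Fiber a,
    (∀ ξ ∈ meas, AEMeasurable (fun a => Inner.inner ℂ (ξ a) (η a)) μ) → η ∈ meas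
  exists_fundamental : ∃ ξ : ℕ → ∀ a, Fiber a, (∀ n, ξ n ∈ meas) ∧
    ∀ a, (Submodule.span ℂ (Set.range fun n => ξ n a)).topologicalClosure = ⊤

namespace HilbertBundle

attribute [instance] HilbertBundle.normed HilbertBundle.inner HilbertBundle.complete

variable {X : Type u} [MeasurableSpace X] {μ : Measure X} (E : HilbertBundle.{u, v} X μ)

theorem aemeasurable_inner {ξ η : ∀ a, E.Fiber a} (hξ : ξ ∈ E.meas) (hη : η ∈ E.meas) :
    AEMeasurable (fun a => Inner.inner ℂ (ξ a) (η a)) μ := by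
  have h : ∀ c : ℂ, AEMeasurable (fun a => ‖ξ a + c • η a‖) μ := fun c =>
    E.norm_meas (ξ + c • η) (E.meas.add_mem hξ (E.meas.smul_mem c hη))
  have h' : ∀ c : ℂ, AEMeasurable (fun a => ‖ξ a - c • η a‖) μ := fun c =>
    E.norm_meas (ξ - c • η) (E.meas.sub_mem hξ (E.meas.smul_mem c hη))
  have e : (fun a => Inner.inner ℂ (ξ a) (η a)) = fun a =>
      (((‖ξ a + (1 : ℂ) • η a‖ : ℝ) : ℂ) ^ 2 - ((‖ξ a - (1 : ℂ) • η a‖ : ℝ) : ℂ) ^ 2 +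
        (((‖ξ a - Complex.I • η a‖ : ℝ) : ℂ) ^ 2 -
          ((‖ξ a + Complex.I • η a‖ : ℝ) : ℂ) ^ 2) * Complex.I) / 4 := by
    funext a
    simpa using inner_eq_sum_norm_sq_div_four (𝕜 := ℂ) (ξ a) (η a)
  rw [e]
  have m : ∀ {g : X → ℝ}, AEMeasurable g μ → AEMeasurable (fun a => ((g a : ℝ) : ℂ)) μ :=
    fun hg => Complex.measurable_ofReal.comp_aemeasurable hg
  exact ((((m (h 1)).pow_const 2).sub ((m (h' 1)).pow_const 2)).add
    ((((m (h' Complex.I)).pow_const 2).sub ((m (h Complex.I)).pow_const 2)).mul_const _)).div_const 4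

/-- The square integrable measurable sections, as a subspace of all sections. -/
def sqIntegrable : Submodule ℂ (∀ a, E.Fiber a) where
  carrier := {ξ | ξ ∈ E.meas ∧ Integrable (fun a => ‖ξ a‖ ^ 2) μ}
  zero_mem' := ⟨E.meas.zero_mem, by simp⟩
  add_mem' := by
    rintro ξ η ⟨hξ, hξ'⟩ ⟨hη, hη'⟩
    have hm := E.meas.add_mem hξ hη
    refine ⟨hm, ((hξ'.add hη').const_mul 2).mono'
      ((E.norm_meas _ hm).pow_const 2).aestronglyMeasurable (Filter.Eventually.of_forall fun a => ?_)⟩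
    have h1 : ‖ξ a + η a‖ ≤ ‖ξ a‖ + ‖η a‖ := norm_add_le _ _
    have h2 : ‖ξ a + η a‖ ^ 2 ≤ (‖ξ a‖ + ‖η a‖) ^ 2 := pow_le_pow_left₀ (norm_nonneg _) h1 2
    simp only [Pi.add_apply, Real.norm_eq_abs, abs_pow, abs_norm]
    nlinarith [sq_nonneg (‖ξ a‖ - ‖η a‖)]
  smul_mem' := by
    rintro c ξ ⟨hξ, hξ'⟩
    refine ⟨E.meas.smul_mem c hξ, ?_⟩
    have e : (fun a => ‖(c • ξ) a‖ ^ 2) = fun a => ‖c‖ ^ 2 * ‖ξ a‖ ^ 2 := by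
      funext a
      simp only [Pi.smul_apply, norm_smul, mul_pow]
    rw [e]
    exact hξ'.const_mul _

/-- The space of square integrable measurable sections, before sections that agree almost
everywhere are identified (a copy of `E.sqIntegrable`, to carry the `L²` seminorm). -/
def SqInt : Type (max u v) := E.sqIntegrable

namespace SqInt

variable {E}

instance : AddCommGroup E.SqInt := inferInstanceAs (AddCommGroup E.sqIntegrable)
instance : Module ℂ E.SqInt := inferInstanceAs (Module ℂ E.sqIntegrable)

/-- The underlying section. -/
def sec (ξ : E.SqInt) : ∀ a, E.Fiber a := (show E.sqIntegrable from ξ).1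

instance : CoeFun E.SqInt (fun _ => ∀ a, E.Fiber a) := ⟨sec⟩

theorem mem_meas (ξ : E.SqInt) : (ξ : ∀ a, E.Fiber a) ∈ E.meas :=
  (show E.sqIntegrable from ξ).2.1

theorem integrable_norm_sq (ξ : E.SqInt) : Integrable (fun a => ‖ξ a‖ ^ 2) μ :=
  (show E.sqIntegrable from ξ).2.2

/-- Build an element from a square integrable measurable section. -/
def of (ξ : ∀ a, E.Fiber a) (h : ξ ∈ E.meas) (h' : Integrable (fun a => ‖ξ a‖ ^ 2) μ) :
    E.SqInt := (⟨ξ, h, h'⟩ : E.sqIntegrable)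

theorem of_apply (ξ : ∀ a, E.Fiber a) (h : ξ ∈ E.meas)
    (h' : Integrable (fun a => ‖ξ a‖ ^ 2) μ) (a : X) : (of ξ h h') a = ξ a := rfl

theorem add_apply (ξ η : E.SqInt) (a : X) : (ξ + η) a = ξ a + η a := rfl
theorem sub_apply (ξ η : E.SqInt) (a : X) : (ξ - η) a = ξ a - η a := rfl
theorem smul_apply (c : ℂ) (ξ : E.SqInt) (a : X) : (c • ξ) a = c • ξ a := rfl

theorem integrable_inner (ξ η : E.SqInt) :
    Integrable (fun a => Inner.inner ℂ (ξ a) (η a)) μ := by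
  refine (ξ.integrable_norm_sq.add η.integrable_norm_sq).mono' (E.aemeasurable_inner ξ.mem_meas η.mem_meas).aestronglyMeasurable
    (Filter.Eventually.of_forall fun a => ?_)
  have h := norm_inner_le_norm (𝕜 := ℂ) (ξ a) (η a)
  simp only [Pi.add_apply]
  nlinarith [sq_nonneg (‖ξ a‖ - ‖η a‖), norm_nonneg (ξ a), norm_nonneg (η a)]

/-- The inner product `∫ ⟨ξ(a), η(a)⟩ dμ(a)`. -/
noncomputable abbrev core : PreInnerProductSpace.Core ℂ E.SqInt where
  inner ξ η := ∫ a, Inner.inner ℂ (ξ a) (η a) ∂μ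
  conj_inner_symm ξ η := by
    rw [← integral_conj]
    exact integral_congr_ae (Filter.Eventually.of_forall fun a => inner_conj_symm _ _)
  re_inner_nonneg ξ := by
    have e : ∀ a, Inner.inner ℂ (ξ a) (ξ a) = ((‖ξ a‖ ^ 2 : ℝ) : ℂ) := fun a => by
      rw [inner_self_eq_norm_sq_to_K]; norm_cast
    simp only [e]
    rw [integral_complex_ofReal]
    exact integral_nonneg fun a => by positivity
  add_left ξ η ζ := by
    simp only [add_apply, inner_add_left]
    exact integral_add (integrable_inner ξ ζ) (integrable_inner η ζ)
  smul_left ξ η c := by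
    simp only [smul_apply, inner_smul_left]
    exact integral_const_mul _ _

noncomputable instance : SeminormedAddCommGroup E.SqInt :=
  @InnerProductSpace.Core.toSeminormedAddCommGroup ℂ E.SqInt _ _ _ core

noncomputable instance : InnerProductSpace ℂ E.SqInt := InnerProductSpace.ofCore core

theorem inner_def (ξ η : E.SqInt) :
    Inner.inner ℂ ξ η = ∫ a, Inner.inner ℂ (ξ a) (η a) ∂μ := rfl

theorem norm_sq (ξ : E.SqInt) : ‖ξ‖ ^ 2 = ∫ a, ‖ξ a‖ ^ 2 ∂μ := by
  have e : ∀ a, Inner.inner ℂ (ξ a) (ξ a) = ((‖ξ a‖ ^ 2 : ℝ) : ℂ) := fun a => by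
    rw [inner_self_eq_norm_sq_to_K]; norm_cast
  rw [InnerProductSpace.norm_sq_eq_re_inner (𝕜 := ℂ), inner_def]
  simp only [e]
  rw [integral_complex_ofReal]
  rfl

theorem integral_norm_le [IsProbabilityMeasure μ] (ξ : E.SqInt) {t : ℝ} (ht : 0 < t)
    (h : ‖ξ‖ ≤ t) : Integrable (fun a => ‖ξ a‖) μ ∧ ∫ a, ‖ξ a‖ ∂μ ≤ t := by
  have hb : ∀ a, ‖ξ a‖ ≤ t / 2 + (1 / (2 * t)) * ‖ξ a‖ ^ 2 := fun a => by
    have e : t / 2 + (1 / (2 * t)) * ‖ξ a‖ ^ 2 - ‖ξ a‖ = (‖ξ a‖ - t) ^ 2 / (2 * t) := by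
      field_simp; ring
    have : 0 ≤ (‖ξ a‖ - t) ^ 2 / (2 * t) := by positivity
    linarith
  have hi : Integrable (fun a => t / 2 + (1 / (2 * t)) * ‖ξ a‖ ^ 2) μ :=
    (integrable_const _).add (ξ.integrable_norm_sq.const_mul _)
  have hI : Integrable (fun a => ‖ξ a‖) μ :=
    hi.mono' (E.norm_meas _ ξ.mem_meas).aestronglyMeasurable
      (Filter.Eventually.of_forall fun a => by simpa using hb a)
  refine ⟨hI, (integral_mono hI hi hb).trans ?_⟩
  rw [integral_add (integrable_const _) (ξ.integrable_norm_sq.const_mul _), integral_const_mul,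
    ← norm_sq]
  have h2 : ‖ξ‖ ^ 2 ≤ t ^ 2 := pow_le_pow_left₀ (norm_nonneg _) h 2
  have h3 : 1 / (2 * t) * ‖ξ‖ ^ 2 ≤ 1 / (2 * t) * t ^ 2 :=
    mul_le_mul_of_nonneg_left h2 (by positivity)
  have h4 : 1 / (2 * t) * t ^ 2 = t / 2 := by field_simp
  simp
  simp at h3 h4
  linarith

/-- Completeness of the space of square integrable sections. -/
instance [IsProbabilityMeasure μ] : CompleteSpace E.SqInt := by
  refine Metric.complete_of_convergent_controlled_sequences (fun n => (1 / 2 : ℝ) ^ n)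
    (fun n => by positivity) fun w hw => ?_
  have hd : ∀ n, ‖w (n + 1) - w n‖ ≤ (1 / 2 : ℝ) ^ n := fun n => by
    rw [← dist_eq_norm]; exact (hw n (n + 1) n (Nat.le_succ n) le_rfl).le
  have hd' := fun n => integral_norm_le (w (n + 1) - w n) (by positivity) (hd n)
  have hae : ∀ᵐ a ∂μ, Summable fun n => ‖(w (n + 1) - w n) a‖ := by
    have hfin : ∫⁻ a, ∑' n, ENNReal.ofReal ‖(w (n + 1) - w n) a‖ ∂μ ≠ ⊤ := by
      rw [lintegral_tsum fun n =>
        (E.norm_meas _ (w (n + 1) - w n).mem_meas).ennreal_ofReal]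
      have hle : ∀ n, ∫⁻ a, ENNReal.ofReal ‖(w (n + 1) - w n) a‖ ∂μ ≤
          ENNReal.ofReal ((1 / 2 : ℝ) ^ n) := fun n => by
        rw [← ofReal_integral_eq_lintegral_ofReal (hd' n).1
          (Filter.Eventually.of_forall fun a => norm_nonneg _)]
        exact ENNReal.ofReal_le_ofReal (hd' n).2
      refine ne_top_of_le_ne_top ?_ (ENNReal.tsum_le_tsum hle)
      exact (summable_geometric_two).tsum_ofReal_ne_top
    filter_upwards [ae_lt_top' (AEMeasurable.tsum fun n =>
        (E.norm_meas _ (w (n + 1) - w n).mem_meas).ennreal_ofReal) hfin] with a ha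
    have := ENNReal.summable_toReal ha.ne
    simpa [ENNReal.toReal_ofReal (norm_nonneg _)] using this
  choose ξ hξ using fun a : X => show ∃ z : E.Fiber a,
      (Summable fun n => ‖(w (n + 1) - w n) a‖) →
        Filter.Tendsto (fun n => w n a) Filter.atTop (𝓝 z) from by
    by_cases h : Summable fun n => ‖(w (n + 1) - w n) a‖
    · have hc : CauchySeq fun n => w n a := cauchySeq_of_summable_dist (by
        refine h.congr fun n => ?_
        rw [dist_comm, dist_eq_norm]; rfl)
      obtain ⟨z, hz⟩ := cauchySeq_tendsto_of_complete hc
      exact ⟨z, fun _ => hz⟩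
    · exact ⟨0, fun h' => absurd h' h⟩
  have hlim : ∀ᵐ a ∂μ, Filter.Tendsto (fun n => w n a) Filter.atTop (𝓝 (ξ a)) := by
    filter_upwards [hae] with a ha using hξ a ha
  have hm : ξ ∈ E.meas := E.mem_meas ξ fun x hx => by
    refine aemeasurable_of_tendsto_metrizable_ae Filter.atTop
      (f := fun n a => Inner.inner ℂ (x a) (w n a))
      (fun n => E.aemeasurable_inner hx (w n).mem_meas) ?_
    filter_upwards [hlim] with a ha using tendsto_const_nhds.inner ha
  have hmN : ∀ N, (fun a => w N a - ξ a) ∈ E.meas := fun N =>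
    E.meas.sub_mem (w N).mem_meas hm
  have hF : ∀ N, ∫⁻ a, ENNReal.ofReal (‖w N a - ξ a‖ ^ 2) ∂μ ≤
      ENNReal.ofReal (((1 / 2 : ℝ) ^ N) ^ 2) := fun N => by
    have h1 : ∫⁻ a, ENNReal.ofReal (‖w N a - ξ a‖ ^ 2) ∂μ =
        ∫⁻ a, Filter.liminf (fun m => ENNReal.ofReal (‖w N a - w m a‖ ^ 2)) Filter.atTop ∂μ := by
      refine lintegral_congr_ae ?_
      filter_upwards [hlim] with a ha
      refine (Filter.Tendsto.liminf_eq ?_).symm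
      exact (ENNReal.continuous_ofReal.tendsto _).comp
        (((tendsto_const_nhds.sub ha).norm).pow 2)
    rw [h1]
    refine (lintegral_liminf_le' fun m => ?_).trans ?_
    · exact ((E.norm_meas _ (w N - w m).mem_meas).pow_const 2).ennreal_ofReal
    · refine Filter.liminf_le_of_frequently_le' (Filter.Eventually.frequently ?_)
      filter_upwards [Filter.eventually_ge_atTop N] with m hmN
      change ∫⁻ a, ENNReal.ofReal (‖(w N - w m) a‖ ^ 2) ∂μ ≤ _
      rw [← ofReal_integral_eq_lintegral_ofReal (w N - w m).integrable_norm_sq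
        (Filter.Eventually.of_forall fun a => by positivity)]
      refine ENNReal.ofReal_le_ofReal ?_
      have := (hw N N m le_rfl hmN).le
      rw [dist_eq_norm] at this
      calc _ = ‖w N - w m‖ ^ 2 := (norm_sq _).symm
        _ ≤ _ := pow_le_pow_left₀ (norm_nonneg _) this 2
  have hI : ∀ N, Integrable (fun a => ‖w N a - ξ a‖ ^ 2) μ := fun N => by
    refine ⟨((E.norm_meas _ (hmN N)).pow_const 2).aestronglyMeasurable, ?_⟩
    rw [hasFiniteIntegral_iff_ofReal (Filter.Eventually.of_forall fun a => by positivity)]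
    exact (hF N).trans_lt ENNReal.ofReal_lt_top
  let D : ℕ → E.SqInt := fun N => of _ (hmN N) (hI N)
  let z : E.SqInt := w 0 - D 0
  have hz : ∀ N, w N - z = D N := fun N => by
    refine Subtype.ext (funext fun a => ?_)
    change w N a - (w 0 a - (w 0 a - ξ a)) = w N a - ξ a
    rw [sub_sub_cancel]
  refine ⟨z, tendsto_iff_dist_tendsto_zero.2 ?_⟩
  refine squeeze_zero (fun _ => dist_nonneg) (fun N => ?_)
    (tendsto_pow_atTop_nhds_zero_of_lt_one (r := (1 / 2 : ℝ)) (by norm_num) (by norm_num))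
  rw [dist_eq_norm, hz]
  refine (sq_le_sq₀ (norm_nonneg _) (by positivity)).1 ?_
  rw [norm_sq]
  refine (ENNReal.ofReal_le_ofReal_iff (by positivity)).1 ?_
  change ENNReal.ofReal (∫ a, ‖w N a - ξ a‖ ^ 2 ∂μ) ≤ _
  rw [ofReal_integral_eq_lintegral_ofReal (hI N)
    (Filter.Eventually.of_forall fun a => by positivity)]
  exact hF N

end SqInt

/-- The Hilbert space `L²(X, {H_a}, μ)`: square integrable measurable sections modulo the sections
of seminorm zero, i.e. modulo equality almost everywhere. -/
abbrev L2 : Type (max u v) := SeparationQuotient E.SqInt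

variable {E} in
/-- The class of a square integrable section. -/
noncomputable abbrev SqInt.cls (ξ : E.SqInt) : E.L2 := SeparationQuotient.mk ξ

/-- A Hilbert subbundle: a measurable field of closed subspaces `M_a ⊆ H_a`, i.e. one for which
some sequence of measurable sections is total in `M_a` for every `a`. -/
structure Subbundle where
  space : ∀ a, Submodule ℂ (E.Fiber a)
  exists_fundamental : ∃ ξ : ℕ → ∀ a, E.Fiber a, (∀ n, ξ n ∈ E.meas) ∧
    ∀ a, (Submodule.span ℂ (Set.range fun n => ξ n a)).topologicalClosure = space a

namespace Subbundle

variable {E} (M : E.Subbundle)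

/-- `μ {a | M_a ≠ 0} > 0` and `μ {a | M_a ≠ H_a} > 0`. -/
def Nontrivial : Prop := 0 < μ {a | M.space a ≠ ⊥} ∧ 0 < μ {a | M.space a ≠ ⊤}

/-- The space `L²(X, {M_a}, μ)` of square integrable sections of the subbundle. -/
def l2 : Submodule ℂ E.L2 where
  carrier := {z | ∃ ξ : E.SqInt, ξ.cls = z ∧ ∀ᵐ a ∂μ, ξ a ∈ M.space a}
  zero_mem' := ⟨0, rfl, Filter.Eventually.of_forall fun a => (M.space a).zero_mem⟩
  add_mem' := by
    rintro _ _ ⟨ξ, rfl, hξ⟩ ⟨η, rfl, hη⟩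
    refine ⟨ξ + η, rfl, ?_⟩
    filter_upwards [hξ, hη] with a h1 h2 using (M.space a).add_mem h1 h2
  smul_mem' := by
    rintro c _ ⟨ξ, rfl, hξ⟩
    refine ⟨c • ξ, rfl, ?_⟩
    filter_upwards [hξ] with a h1 using (M.space a).smul_mem c h1

end Subbundle
end HilbertBundle

/-! ### Representations of the groupoid -/

section Representations

variable {G : Type u} [TopologicalSpace G] [MeasurableSpace G] [LocallyCompactGroupoid G]

/-- Transport of an operator `H_{d(x)} → H_{r(x)}` along equalities of the endpoints. -/
def transport {H : G0 G → Type v} [∀ a, NormedAddCommGroup (H a)]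
    [∀ a, InnerProductSpace ℂ (H a)] (op : ∀ x : G, H (d x) →L[ℂ] H (r x))
    {a b : G0 G} (x : G) (hd : d x = a) (hr : r x = b) : H a →L[ℂ] H b := by
  subst hd hr
  exact op x

/-- An (almost everywhere) representation `L` of `G`: a quasi-invariant probability measure `μ` on
`G⁰`, a Hilbert bundle over `(G⁰, μ)`, and operators `L(x) : H_{d(x)} → H_{r(x)}` that are unitary
for almost every `x` in the reduction of `G` to a conull set `U` (the values `L(x)` at other `x`
are irrelevant), with the four usual axioms holding almost everywhere. -/
structure Representation (hs : HaarSystem G) where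
  μ : Measure (G0 G)
  [prob : IsProbabilityMeasure μ]
  quasiInvariant : hs.QuasiInvariant μ
  bundle : HilbertBundle.{u, v} (G0 G) μ
  U : Set (G0 G)
  conull : μ Uᶜ = 0
  op : ∀ x : G, bundle.Fiber (d x) →L[ℂ] bundle.Fiber (r x)
  unitary : ∀ᵐ x ∂(hs.nu μ), r x ∈ U → d x ∈ U → Isometry (op x) ∧ Function.Bijective (op x)
  op_unit : ∀ᵐ a ∂μ, transport op a.1 (d_unit a) (r_unit a) =
    ContinuousLinearMap.id ℂ (bundle.Fiber a)
  op_mul : ∀ᵐ p ∂(hs.nu2 μ), ∀ h : p ∈ AlgGroupoid.comp (G := G),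
    (op p.1).comp (transport op p.2 rfl (d_eq_r h).symm) =
      transport op (AlgGroupoid.mul p.1 p.2) (d_mul h) (r_mul h)
  op_inv : ∀ᵐ x ∂(hs.nu μ),
    (transport op (AlgGroupoid.inv x) (d_inv x) (r_inv x)).comp (op x) =
        ContinuousLinearMap.id ℂ (bundle.Fiber (d x)) ∧
      (op x).comp (transport op (AlgGroupoid.inv x) (d_inv x) (r_inv x)) =
        ContinuousLinearMap.id ℂ (bundle.Fiber (r x))
  coeff_meas : ∀ ξ η : bundle.SqInt,
    AEMeasurable (fun x => Inner.inner ℂ (η (r x)) (op x (ξ (d x)))) (hs.nu μ)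

attribute [instance] Representation.prob

namespace Representation

variable {hs : HaarSystem G} (L : Representation.{u, v} hs)

/-- The Hilbert space of the integrated representation: the `L²`-sections of the bundle. -/
abbrev Space : Type (max u v) := L.bundle.L2

/-- Invariance of a subbundle: `L(x) M_{d(x)} ⊆ M_{r(x)}` for almost every `x`. -/
def Invariant (M : L.bundle.Subbundle) : Prop :=
  ∀ᵐ x ∂(hs.nu L.μ), ∀ v ∈ M.space (d x), L.op x v ∈ M.space (r x)

/-- `L` is reducible: it admits a nontrivial invariant subbundle. -/
def Reducible : Prop := ∃ M : L.bundle.Subbundle, M.Nontrivial ∧ L.Invariant M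

/-- `L` is irreducible: it is not reducible. -/
def Irreducible : Prop := ¬ L.Reducible

/-- `T = π_L(f)`: for all square integrable sections `ξ, η`,
`⟨Tξ, η⟩ = ∫ f(x) ⟨L(x) ξ(d(x)), η(r(x))⟩ dν₀(x)`, where the integrals converge. (Mathlib's inner
product is linear in its second argument.) Such a `T` is unique. -/
def IsIntegrated (f : G → ℂ) (T : L.Space →L[ℂ] L.Space) : Prop :=
  ∀ ξ η : L.bundle.SqInt,
    Integrable (fun x => f x * Inner.inner ℂ (η (r x)) (L.op x (ξ (d x)))) (hs.nu0 L.μ) ∧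
      Inner.inner ℂ η.cls (T ξ.cls) =
        ∫ x, f x * Inner.inner ℂ (η (r x)) (L.op x (ξ (d x))) ∂(hs.nu0 L.μ)

end Representation

end Representations

/-! ### The C⋆-algebra of the groupoid -/

/-- The C⋆-algebra of bounded families `(a_i)` of operators on Hilbert spaces `H_i`, with the norm
`sup_i ‖a_i‖` and the pointwise operations. -/
def BoundedFamilies {ι : Type*} (H : ι → Type*) [∀ i, NormedAddCommGroup (H i)]
    [∀ i, InnerProductSpace ℂ (H i)] : Type _ :=
  lp (fun i => H i →L[ℂ] H i) ⊤

namespace BoundedFamilies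

variable {ι : Type*} {H : ι → Type*} [∀ i, NormedAddCommGroup (H i)]
  [∀ i, InnerProductSpace ℂ (H i)]

/-- The member with index `i` of a family. -/
def app (a : BoundedFamilies H) (i : ι) : H i →L[ℂ] H i :=
  (show lp (fun i => H i →L[ℂ] H i) ⊤ from a).1 i

noncomputable instance [∀ i, CompleteSpace (H i)] : NonUnitalCStarAlgebra (BoundedFamilies H) :=
  inferInstanceAs (NonUnitalCStarAlgebra (lp (fun i => H i →L[ℂ] H i) ⊤))

theorem norm_eq [∀ i, CompleteSpace (H i)] (a : BoundedFamilies H) : ‖a‖ = ⨆ i, ‖a.app i‖ :=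
  lp.norm_eq_ciSup (show lp (fun i => H i →L[ℂ] H i) ⊤ from a)

end BoundedFamilies

section CStarAlgebraOfGroupoid

variable {G : Type u} [TopologicalSpace G] [MeasurableSpace G] [LocallyCompactGroupoid G]
  (hs : HaarSystem G)

/-- Families of operators indexed by all representations `L` of `G` (over all quasi-invariant
probability measures and all Hilbert bundles). -/
abbrev OperatorFamilies : Type _ := BoundedFamilies fun L : Representation.{u, v} hs => L.Space

/-- The image of `C_c(G)` in the product of all integrated representations: the families
`(π_L(f))_L` with `f ∈ C_c(G)`, whose norm is `sup_L ‖π_L(f)‖`. -/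
def integratedFamilies : Set (OperatorFamilies.{u, v} hs) :=
  {a | ∃ f ∈ Cc G, ∀ L : Representation.{u, v} hs, L.IsIntegrated f (a.app L)}

/-- `C⋆(G)`, the completion of `C_c(G)` for the norm `sup_L ‖π_L(f)‖`, is realised as the closed
⋆-subalgebra generated by the image of `C_c(G)` in the product of all integrated representations.
(By `π_L(f) π_L(g) = π_L(f * g)` and `π_L(f)⋆ = π_L(f⋆)` that image is a ⋆-subalgebra already.) -/
noncomputable def cstarSubalgebra : NonUnitalStarSubalgebra ℂ (OperatorFamilies.{u, v} hs) :=
  (NonUnitalStarAlgebra.adjoin ℂ (integratedFamilies.{u, v} hs)).topologicalClosure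

/-- The C⋆-algebra `C⋆(G)`. -/
def CStar : Type _ := cstarSubalgebra.{u, v} hs

noncomputable instance : NonUnitalCStarAlgebra (CStar.{u, v} hs) :=
  NonUnitalStarSubalgebra.nonUnitalCStarAlgebra (cstarSubalgebra.{u, v} hs)
    (h_closed := NonUnitalStarSubalgebra.isClosed_topologicalClosure _)

variable {hs}

/-- The family of operators that an element of `C⋆(G)` is. -/
def CStar.val (a : CStar.{u, v} hs) : OperatorFamilies.{u, v} hs :=
  (show cstarSubalgebra.{u, v} hs from a).1

/-- The representation `π_L` of `C⋆(G)`: the extension of `f ↦ π_L(f)` from `C_c(G)`. -/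
noncomputable def Representation.pi (L : Representation.{u, v} hs) :
    CStar.{u, v} hs →⋆ₙₐ[ℂ] (L.Space →L[ℂ] L.Space) where
  toFun a := a.val.app L
  map_smul' _ _ := rfl
  map_zero' := rfl
  map_add' _ _ := rfl
  map_mul' _ _ := rfl
  map_star' _ := rfl

end CStarAlgebraOfGroupoid

section Reducible

variable {A : Type*} [NonUnitalCStarAlgebra A] {H : Type*} [NormedAddCommGroup H]
  [InnerProductSpace ℂ H] [CompleteSpace H] (π : A →⋆ₙₐ[ℂ] (H →L[ℂ] H))

/-- `K` is a nontrivial closed subspace that is invariant under `π`. -/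
def IsNontrivialInvariant (K : Submodule ℂ H) : Prop :=
  IsClosed (K : Set H) ∧ K ≠ ⊥ ∧ K ≠ ⊤ ∧ ∀ a : A, ∀ v ∈ K, π a v ∈ K

/-- A representation of a C⋆-algebra is reducible if it has a nontrivial invariant closed
subspace. -/
def ReducibleRep : Prop := ∃ K : Submodule ℂ H, IsNontrivialInvariant π K

/-- A representation of a C⋆-algebra is irreducible if it is not reducible. -/
def IrreducibleRep : Prop := ¬ ReducibleRep π

end Reducible

end LCGroupoid

set_option linter.unusedSectionVars false
set_option linter.unusedVariables false

/-! Everything rests on the coefficients ⟨L(x)ξ(d(x)), η(r(x))⟩. By `ae_eq_zero_of_forall_Cc` such a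
coefficient vanishes ν-a.e. as soon as ⟨π_L(f)ξ, η⟩ = 0 for all f in C_c(G); the converse is
immediate.

From subbundles to subspaces: a section orthogonal to M(μ) is a.e. pointwise orthogonal to M_a,
because M(μ) is stable under restriction to measurable sets. Invariance of M then kills the
coefficients between M(μ) and its complement, so π_L(f) preserves M(μ). Since L(x⁻¹) inverts L(x),
also M_{r(x)} ⊆ L(x)M_{d(x)} a.e., which gives the same for the adjoint of π_L(f). Invariance passes
to the closed ⋆-algebra generated (`pi_mem_of_forall_integrated`).

From subspaces to subbundles: let K be closed and invariant. Coefficients between K and Kᗮ vanish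
a.e. Cutting η in Kᗮ down to a measurable set keeps it orthogonal to π_L(f)K, and nondegeneracy
(`cls_eq_zero_of_forall_pi`) upgrades this to orthogonality to K. Hence K and Kᗮ are pointwise
orthogonal (`ae_inner_eq_zero_of_invariant`). Splitting a fundamental sequence as e_n = ξ_n + η_n
along K ⊕ Kᗮ, the closed spans of the ξ_n(a) form the required subbundle.

A preliminary point is that π_L(f) exists and is bounded uniformly in L, so that f gives an element
of C⋆(G) (`exists_cstar`). This is a Cauchy-Schwarz estimate in which δ^(-1/2) balances ν against
ν⁻¹. -/

namespace LCGroupoid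

/-! ### Charts of a non-Hausdorff groupoid and the space C_c(G) -/

section Topological

variable {G : Type u} [TopologicalSpace G] [LocallyCompactGroupoid G]

attribute [instance] LocallyCompactGroupoid.t2_units LocallyCompactGroupoid.t2_fiber

theorem continuous_r : Continuous (r : G → G0 G) := by
  refine Continuous.subtype_mk ?_ _
  exact LocallyCompactGroupoid.continuousOn_mul.comp_continuous
    (continuous_id.prodMk LocallyCompactGroupoid.continuous_inv) fun x => comp_inv x

variable (G) in
/-- The inverse map as a homeomorphism. -/
def invHomeomorph : G ≃ₜ G where
  toFun := AlgGroupoid.inv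
  invFun := AlgGroupoid.inv
  left_inv := AlgGroupoid.inv_inv
  right_inv := AlgGroupoid.inv_inv
  continuous_toFun := LocallyCompactGroupoid.continuous_inv
  continuous_invFun := LocallyCompactGroupoid.continuous_inv

/-- Compact subsets of G need not be closed, so it is closedness of the fibre, from the Hausdorff
unit space, that makes their traces on the fibre compact. -/
theorem isClosedEmbedding_fiber (a : G0 G) :
    IsClosedEmbedding (Subtype.val : RFiber a → G) :=
  (isClosed_singleton.preimage continuous_r : IsClosed {x : G | r x = a}).isClosedEmbedding_subtypeVal

variable (G) in
theorem secondCountable : SecondCountableTopology G := by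
  obtain ⟨C, hC, -, hb⟩ := LocallyCompactGroupoid.basis (G := G)
  exact hb.secondCountableTopology (hC.image _)

/-- An open set that is contained in a compact Hausdorff set. -/
def IsChart (V : Set G) : Prop := IsOpen V ∧ ∃ K, V ⊆ K ∧ IsCompact K ∧ T2Space K

theorem IsChart.mono {V W : Set G} (hV : IsChart V) (hW : IsOpen W) (h : W ⊆ V) : IsChart W :=
  ⟨hW, hV.2.imp fun _ hK => ⟨h.trans hK.1, hK.2⟩⟩

variable (G) in
theorem exists_chart_cover : ∃ V : ℕ → Set G, (∀ n, IsChart (V n)) ∧ ⋃ n, V n = Set.univ := by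
  obtain ⟨C, hC, hK, hb⟩ := LocallyCompactGroupoid.basis (G := G)
  -- Adding ∅ makes the family nonempty, so that ℕ can enumerate it.
  obtain ⟨K, hKC⟩ := (hC.insert ∅).exists_eq_range (Set.insert_nonempty _ _)
  have hmem : ∀ n, K n ∈ insert ∅ C := fun n => hKC ▸ Set.mem_range_self n
  refine ⟨fun n => interior (K n), fun n => ⟨isOpen_interior, K n, interior_subset, ?_⟩, ?_⟩
  · rcases hmem n with h | h
    · rw [h]
      exact ⟨isCompact_empty, inferInstance⟩
    · exact hK _ h
  · refine Set.eq_univ_of_forall fun x => ?_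
    obtain ⟨_, ⟨A, hA, rfl⟩, hx, -⟩ := hb.exists_subset_of_mem_open (Set.mem_univ x) isOpen_univ
    have : A ∈ Set.range K := hKC ▸ Set.mem_insert_of_mem _ hA
    obtain ⟨n, rfl⟩ := this
    exact Set.mem_iUnion.2 ⟨n, hx⟩

theorem IsChart.t2Space {V : Set G} (hV : IsChart V) : T2Space V := by
  obtain ⟨-, K, hVK, -, hK⟩ := hV
  exact (IsEmbedding.inclusion hVK).t2Space

theorem IsChart.locallyCompactSpace {V : Set G} (hV : IsChart V) : LocallyCompactSpace V := by
  obtain ⟨ho, K, hVK, hKc, hK⟩ := hV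
  have : CompactSpace K := isCompact_iff_compactSpace.1 hKc
  have he : IsOpenEmbedding (Set.inclusion hVK) :=
    ⟨IsEmbedding.inclusion hVK, by
      rw [Set.range_inclusion]; exact ho.preimage continuous_subtype_val⟩
  exact he.locallyCompactSpace

/-- Continuous with compact support in the open set `V`, and zero outside. -/
def IsBump (V : Set G) (f : G → ℂ) : Prop :=
  ContinuousOn f V ∧ ∃ K ⊆ V, IsCompact K ∧ ∀ x ∉ K, f x = 0

theorem IsBump.mem_Cc {V : Set G} {f : G → ℂ} (h : IsBump V f) (hV : IsChart V) : f ∈ Cc G :=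
  Submodule.subset_span ⟨V, hV.1, hV.t2Space, h.1, h.2⟩

theorem IsBump.mul {V W : Set G} {f g : G → ℂ} (hf : IsBump W f) (hg : ContinuousOn g V)
    (h : W ⊆ V) : IsBump W (fun x => f x * g x) := by
  obtain ⟨hc, K, hK, hKc, h0⟩ := hf
  exact ⟨hc.mul (hg.mono h), K, hK, hKc, fun x hx => by simp [h0 x hx]⟩

/-- The indicator function of a chart is a pointwise limit of functions in `C_c(G)` with values in
the unit disc. -/
theorem IsChart.exists_seq {W : Set G} (hW : IsChart W) : ∃ f : ℕ → G → ℂ,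
    (∀ n, IsBump W (f n)) ∧ (∀ n x, ‖f n x‖ ≤ W.indicator 1 x) ∧
      ∀ x, Filter.Tendsto (fun n => f n x) Filter.atTop (𝓝 (W.indicator 1 x)) := by
  classical
  have := hW.t2Space
  have := hW.locallyCompactSpace
  have := secondCountable G
  -- W is σ-compact; the approximants are Urysohn functions equal to 1 on the n-th compact set of an
  -- exhaustion, so at each point the sequence is eventually constant.
  let K := CompactExhaustion.choice W
  choose g hg1 hgc _ hg01 using fun n =>
    exists_continuousMap_one_of_isCompact_subset_isOpen (K.isCompact n) isOpen_univ
      (Set.subset_univ _)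
  have hext : ∀ n (x : W), (if h : (x : G) ∈ W then ((g n ⟨x, h⟩ : ℝ) : ℂ) else 0) =
      ((g n x : ℝ) : ℂ) := fun n x => by simp
  refine ⟨fun n x => if h : x ∈ W then ((g n ⟨x, h⟩ : ℝ) : ℂ) else 0, fun n => ⟨?_, ?_⟩, ?_, ?_⟩
  · rw [continuousOn_iff_continuous_domRestrict]
    refine (Complex.continuous_ofReal.comp (g n).continuous).congr fun x => (hext n x).symm
  · refine ⟨Subtype.val '' tsupport (g n), by simp, (hgc n).image continuous_subtype_val,
      fun x hx => ?_⟩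
    beta_reduce
    by_cases h : x ∈ W
    · rw [dif_pos h, image_eq_zero_of_notMem_tsupport fun hx' => hx ⟨_, hx', rfl⟩]
      simp
    · rw [dif_neg h]
  · intro n x
    by_cases h : x ∈ W
    · have := hg01 n ⟨x, h⟩
      simp only [dif_pos h, Set.indicator_of_mem h, Complex.norm_real, Real.norm_eq_abs,
        abs_of_nonneg this.1]
      exact this.2
    · simp [h]
  · intro x
    by_cases h : x ∈ W
    · have hx : (⟨x, h⟩ : W) ∈ ⋃ n, K n := by rw [K.iUnion_eq]; trivial
      obtain ⟨N, hN⟩ := Set.mem_iUnion.1 hx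
      refine tendsto_const_nhds.congr' ?_
      filter_upwards [Filter.eventually_ge_atTop N] with n hn
      simp [h, hg1 n (K.subset hn hN)]
    · simp [h]

/-- Fibres are Hausdorff, so there membership in `Cc` means ordinary continuity with compact
support, whence integrability. -/
theorem comp_fiber_mem_Cc {f : G → ℂ} (hf : f ∈ Cc G) (a : G0 G) :
    (fun z : RFiber a => f z.1) ∈ Cc (RFiber a) := by
  induction hf using Submodule.span_induction with
  | mem f hf =>
    obtain ⟨V, hV, _, hfV, K, hKV, hK, h0⟩ := hf
    refine Submodule.subset_span ⟨Subtype.val ⁻¹' V, hV.preimage continuous_subtype_val,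
      inferInstance, hfV.comp continuous_subtype_val.continuousOn fun _ h => h,
      Subtype.val ⁻¹' K, fun _ h => hKV h, (isClosedEmbedding_fiber a).isCompact_preimage hK,
      fun x hx => h0 _ hx⟩
  | zero => exact Submodule.zero_mem _
  | add f g _ _ hf hg => exact Submodule.add_mem _ hf hg
  | smul c f _ hf => exact Submodule.smul_mem _ c hf

theorem comp_inv_mem_Cc {f : G → ℂ} (hf : f ∈ Cc G) :
    (fun x => f (AlgGroupoid.inv x)) ∈ Cc G := by
  induction hf using Submodule.span_induction with
  | mem f hf =>
    obtain ⟨V, hV, _, hfV, K, hKV, hK, h0⟩ := hf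
    have hc := LocallyCompactGroupoid.continuous_inv (G := G)
    refine Submodule.subset_span ⟨AlgGroupoid.inv ⁻¹' V, hV.preimage hc, ?_,
      hfV.comp hc.continuousOn fun _ h => h, AlgGroupoid.inv ⁻¹' K, fun _ h => hKV h,
      (invHomeomorph G).isCompact_preimage.2 hK, fun x hx => h0 _ hx⟩
    refine T2Space.of_injective_continuous
      (f := fun x : AlgGroupoid.inv ⁻¹' V => (⟨AlgGroupoid.inv x.1, x.2⟩ : V)) ?_
      ((hc.comp continuous_subtype_val).subtype_mk _)
    intro x y h
    exact Subtype.ext ((invHomeomorph G).injective (congrArg Subtype.val h))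
  | zero => exact Submodule.zero_mem _
  | add f g _ _ hf hg => exact Submodule.add_mem _ hf hg
  | smul c f _ hf => exact Submodule.smul_mem _ c hf

end Topological

/-! ### Measurability of the Haar system and finiteness of the I-norm -/

section Measurable

variable {G : Type u} [TopologicalSpace G] [MeasurableSpace G] [BorelSpace G]
  [LocallyCompactGroupoid G]

theorem measurable_r : Measurable (r : G → G0 G) := continuous_r.measurable

theorem measurable_inv : Measurable (AlgGroupoid.inv : G → G) :=
  LocallyCompactGroupoid.continuous_inv.measurable

/-- Such functions can be discontinuous on G, but each generator is continuous on an open set and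
zero off it, hence Borel. -/
theorem measurable_of_mem_Cc {f : G → ℂ} (hf : f ∈ Cc G) : Measurable f := by
  induction hf using Submodule.span_induction with
  | mem f hf =>
    obtain ⟨V, hV, _, hfV, K, hKV, hK, h0⟩ := hf
    refine measurable_of_restrict_of_restrict_compl hV.measurableSet
      (continuousOn_iff_continuous_domRestrict.1 hfV).measurable ?_
    convert measurable_const (a := (0 : ℂ)) using 1
    funext x
    exact h0 _ fun h => x.2 (hKV h)
  | zero => exact measurable_const
  | add f g _ _ hf hg => exact hf.add hg
  | smul c f _ hf => exact hf.const_smul c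

namespace HaarSystem

variable (hs : HaarSystem G)

theorem lam_apply_open_lt_top (a : G0 G) {V : Set G} (hV : IsChart V) :
    hs.lam a V < ⊤ := by
  have := hs.regular a
  obtain ⟨ho, K, hVK, hK, -⟩ := hV
  rw [lam, Measure.map_apply measurable_subtype_coe ho.measurableSet]
  exact (measure_mono (Set.preimage_mono hVK)).trans_lt
    ((isClosedEmbedding_fiber a).isCompact_preimage hK).measure_lt_top

theorem integral_lam (a : G0 G) {f : G → ℂ} (hf : Measurable f) :
    ∫ x, f x ∂(hs.lam a) = ∫ z, f z.1 ∂(hs.measure a) :=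
  integral_map measurable_subtype_coe.aemeasurable hf.aestronglyMeasurable

/-- A pointwise limit of the continuous functions a ↦ ∫ f_n dλᵃ, with f_n in C_c(G) tending to the
indicator of the chart. -/
theorem measurable_lam_apply_chart {W : Set G} (hW : IsChart W) :
    Measurable fun a => hs.lam a W := by
  obtain ⟨f, hf, hf1, hlim⟩ := hW.exists_seq
  have hm : ∀ n, Measurable (f n) := fun n => measurable_of_mem_Cc ((hf n).mem_Cc hW)
  have h1 : Measurable fun a => ∫ x, W.indicator (1 : G → ℂ) x ∂(hs.lam a) := by
    refine measurable_of_tendsto_metrizable (f := fun n a => ∫ x, f n x ∂(hs.lam a))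
      (fun n => ?_) (tendsto_pi_nhds.2 fun a => ?_)
    · simp only [hs.integral_lam _ (hm n)]
      exact (hs.continuous_integral _ ((hf n).mem_Cc hW)).1.measurable
    · refine tendsto_integral_of_dominated_convergence (W.indicator 1)
        (fun n => (hm n).aestronglyMeasurable) ?_
        (fun n => Filter.Eventually.of_forall (hf1 n)) (Filter.Eventually.of_forall hlim)
      rw [integrable_indicator_iff hW.1.measurableSet]
      exact integrableOn_const (hs.lam_apply_open_lt_top a hW).ne
  have h2 : (fun a => hs.lam a W) =
      fun a => ENNReal.ofReal (∫ x, W.indicator (1 : G → ℂ) x ∂(hs.lam a)).re := by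
    funext a
    rw [integral_indicator hW.1.measurableSet]
    simp [Measure.real, ENNReal.ofReal_toReal (hs.lam_apply_open_lt_top a hW).ne]
  rw [h2]
  exact (Complex.measurable_re.comp h1).ennreal_ofReal

/-- This is what makes `Measure.bind` in the definition of ν compute the integral of the λᵃ. On a
chart the measures are finite, so the open sets suffice as a π-system; the charts are then glued
along a disjointed countable cover. -/
theorem measurable_lam : Measurable hs.lam := by
  obtain ⟨V, hV, hcov⟩ := exists_chart_cover G
  have key : ∀ n, Measurable fun a => (hs.lam a).restrict (V n) := fun n => by
    have : ∀ a, IsFiniteMeasure ((hs.lam a).restrict (V n)) := fun a =>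
      isFiniteMeasure_restrict.2 (hs.lam_apply_open_lt_top a (hV n)).ne
    have hO : ∀ W, IsOpen W → Measurable fun a => (hs.lam a).restrict (V n) W := fun W hW => by
      simp only [Measure.restrict_apply hW.measurableSet]
      exact hs.measurable_lam_apply_chart
        ((hV n).mono (hW.inter (hV n).1) Set.inter_subset_right)
    exact Measurable.measure_of_isPiSystem (S := {s | IsOpen s}) (BorelSpace.measurable_eq)
      isPiSystem_isOpen hO (hO _ isOpen_univ)
  refine Measure.measurable_of_measurable_coe _ fun s hs' => ?_
  have hVm : ∀ n, MeasurableSet (V n) := fun n => (hV n).1.measurableSet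
  have h : ∀ a, hs.lam a s = ∑' n, (hs.lam a).restrict (V n) (s ∩ disjointed V n) := fun a => by
    have hd : ∀ n, MeasurableSet (s ∩ disjointed V n) := fun n =>
      hs'.inter (MeasurableSet.disjointed hVm n)
    conv_lhs => rw [← Set.inter_univ s, ← hcov, ← iUnion_disjointed, Set.inter_iUnion]
    rw [measure_iUnion (fun i j hij => ?_) hd]
    · refine tsum_congr fun n => ?_
      rw [Measure.restrict_apply (hd n),
        Set.inter_eq_left.2 (Set.inter_subset_right.trans (disjointed_subset V n))]
    · exact ((disjoint_disjointed V hij).mono Set.inter_subset_right Set.inter_subset_right)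
  simp only [h]
  exact Measurable.tsum fun n =>
    (Measure.measurable_coe (hs'.inter (MeasurableSet.disjointed hVm n))).comp (key n)

theorem integrable_of_mem_Cc {f : G → ℂ} (hf : f ∈ Cc G) (a : G0 G) :
    Integrable (fun z : RFiber a => f z.1) (hs.measure a) := by
  have := hs.regular a
  obtain ⟨h1, h2⟩ := mem_Cc_iff.1 (comp_fiber_mem_Cc hf a)
  exact h1.integrable_of_hasCompactSupport h2

theorem lintegral_lam (a : G0 G) {f : G → ENNReal} (hf : Measurable f) :
    ∫⁻ x, f x ∂(hs.lam a) = ∫⁻ z, f z.1 ∂(hs.measure a) :=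
  lintegral_map hf measurable_subtype_coe

/-- A function in `C_c(G)` has a finite `I`-norm. -/
theorem exists_lintegral_le {f : G → ℂ} (hf : f ∈ Cc G) :
    ∃ C : NNReal, ∀ a, ∫⁻ x, ‖f x‖ₑ ∂(hs.lam a) ≤ C := by
  induction hf using Submodule.span_induction with
  | mem f hf =>
    obtain ⟨V, hV, hV2, hfV, K, hKV, hK, h0⟩ := hf
    -- For a generator f, |f| is again in C_c(G), so a ↦ ∫ |f| dλᵃ is continuous with compact
    -- support and therefore bounded.
    have hn : (fun x => ((‖f x‖ : ℝ) : ℂ)) ∈ Cc G := Submodule.subset_span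
      ⟨V, hV, hV2, Complex.continuous_ofReal.comp_continuousOn hfV.norm, K, hKV, hK,
        fun x hx => by simp [h0 x hx]⟩
    have hf : f ∈ Cc G := Submodule.subset_span ⟨V, hV, hV2, hfV, K, hKV, hK, h0⟩
    obtain ⟨hc, hcs⟩ := hs.continuous_integral _ hn
    obtain ⟨C, hC⟩ := hcs.exists_bound_of_continuous hc
    refine ⟨C.toNNReal, fun a => ?_⟩
    rw [hs.lintegral_lam a (measurable_of_mem_Cc hf).enorm]
    have hi := (hs.integrable_of_mem_Cc hf a).norm
    have h2 := hC a
    rw [integral_complex_ofReal, Complex.norm_real] at h2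
    simp only [← ofReal_norm]
    rw [← ofReal_integral_eq_lintegral_ofReal hi (Filter.Eventually.of_forall fun a => norm_nonneg _)]
    exact ENNReal.ofReal_le_ofReal ((le_abs_self _).trans h2)
  | zero => exact ⟨0, fun a => by simp⟩
  | add f g hf hg h h' =>
    obtain ⟨C, hC⟩ := h
    obtain ⟨D, hD⟩ := h'
    refine ⟨C + D, fun a => ?_⟩
    push_cast
    refine le_trans ?_ (add_le_add (hC a) (hD a))
    rw [← lintegral_add_left (measurable_of_mem_Cc hf).enorm]
    exact lintegral_mono fun x => enorm_add_le _ _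
  | smul c f hf h =>
    obtain ⟨C, hC⟩ := h
    refine ⟨‖c‖₊ * C, fun a => ?_⟩
    push_cast
    simp only [Pi.smul_apply, enorm_smul]
    rw [lintegral_const_mul _ (measurable_of_mem_Cc hf).enorm]
    exact mul_le_mul_right (hC a) _

end HaarSystem
end Measurable
end LCGroupoid

/-! ### Testing against C_c(G) -/

namespace LCGroupoid

variable {G : Type u} [TopologicalSpace G] [MeasurableSpace G] [BorelSpace G]
  [LocallyCompactGroupoid G]

/-- A function whose products with all functions in `C_c(G)` have integral zero vanishes almost
everywhere. -/
theorem ae_eq_zero_of_forall_Cc {ρ : Measure G} {h : G → ℂ}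
    (hi : ∀ f ∈ Cc G, Integrable (fun x => f x * h x) ρ)
    (h0 : ∀ f ∈ Cc G, ∫ x, f x * h x ∂ρ = 0) : ∀ᵐ x ∂ρ, h x = 0 := by
  obtain ⟨V, hV, hcov⟩ := exists_chart_cover G
  -- Only the products f h are known to be integrable, so they are treated first; h is recovered by
  -- letting f increase to the indicator of a chart.
  suffices key : ∀ n, ∀ f, IsBump (V n) f → ∀ᵐ x ∂ρ, f x * h x = 0 by
    choose F hF _ hlim using fun n => (hV n).exists_seq
    have h1 : ∀ᵐ x ∂ρ, ∀ n m, F n m x * h x = 0 :=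
      ae_all_iff.2 fun n => ae_all_iff.2 fun m => key n _ (hF n m)
    filter_upwards [h1] with x hx
    obtain ⟨n, hn⟩ := Set.mem_iUnion.1 (hcov.symm ▸ Set.mem_univ x : x ∈ ⋃ n, V n)
    have h2 := (hlim n x).mul_const (h x)
    simp only [hx, Set.indicator_of_mem hn, Pi.one_apply, one_mul] at h2
    exact (tendsto_nhds_unique h2 tendsto_const_nhds)
  intro n f hf
  have hfi := hi f (hf.mem_Cc (hV n))
  -- On W ∩ V_n the approximants g_m of the indicator satisfy g_m f ∈ C_c(G), and f vanishes off
  -- V_n, so dominated convergence gives the integral over W.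
  have hopen : ∀ W, IsOpen W → ∫ x in W, f x * h x ∂ρ = 0 := by
    intro W hW
    have hWV : IsChart (W ∩ V n) := (hV n).mono (hW.inter (hV n).1) Set.inter_subset_right
    obtain ⟨g, hg, hg1, hlim⟩ := hWV.exists_seq
    have hgm : ∀ m, Measurable (g m) := fun m => measurable_of_mem_Cc ((hg m).mem_Cc hWV)
    have hgf : ∀ m, (fun x => g m x * f x) ∈ Cc G := fun m =>
      ((hg m).mul hf.1 Set.inter_subset_right).mem_Cc hWV
    rw [← integral_indicator hW.measurableSet]
    have h2 : Filter.Tendsto (fun m => ∫ x, g m x * (f x * h x) ∂ρ) Filter.atTop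
        (𝓝 (∫ x, W.indicator (fun x => f x * h x) x ∂ρ)) := by
      refine tendsto_integral_of_dominated_convergence (fun x => ‖f x * h x‖)
        (fun m => (hgm m).aestronglyMeasurable.mul hfi.1) hfi.norm
        (fun m => Filter.Eventually.of_forall fun x => ?_) (Filter.Eventually.of_forall fun x => ?_)
      · rw [norm_mul]
        refine mul_le_of_le_one_left (norm_nonneg _) ((hg1 m x).trans ?_)
        exact Set.indicator_le_self' (fun _ _ => zero_le_one) x
      · have h3 := (hlim x).mul_const (f x * h x)
        convert h3 using 2
        by_cases hxW : x ∈ W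
        · by_cases hxV : x ∈ V n
          · rw [Set.indicator_of_mem hxW, Set.indicator_of_mem (Set.mem_inter hxW hxV)]
            simp
          · obtain ⟨-, K, hKV, -, hK0⟩ := hf
            rw [Set.indicator_of_mem hxW, hK0 x fun hx => hxV (hKV hx)]
            simp
        · rw [Set.indicator_of_notMem hxW, Set.indicator_of_notMem fun hx => hxW hx.1]
          simp
    refine tendsto_nhds_unique h2 ?_
    simp only [← mul_assoc, h0 _ (hgf _)]
    exact tendsto_const_nhds
  refine hfi.ae_eq_zero_of_forall_setIntegral_eq_zero fun s hs _ => ?_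
  clear ‹ρ s < ⊤›
  induction s, hs using MeasurableSpace.induction_on_inter
    (BorelSpace.measurable_eq (α := G)) isPiSystem_isOpen with
  | empty => simp
  | basic W hW => exact hopen W hW
  | compl W hW ih =>
    have h1 := integral_add_compl hW hfi
    have h2 := hopen Set.univ isOpen_univ
    rw [setIntegral_univ] at h2
    rwa [ih, h2, zero_add] at h1
  | iUnion s hd hm ih =>
    rw [integral_iUnion hm hd hfi.integrableOn]
    simp [ih]

/-! ### The measures ν, ν⁻¹ and ν₀ -/

namespace HaarSystem

variable (hs : HaarSystem G) (μ : Measure (G0 G))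

theorem ae_lam (a : G0 G) : ∀ᵐ x ∂(hs.lam a), r x = a :=
  (ae_map_iff measurable_subtype_coe.aemeasurable
    (isClosed_singleton.preimage continuous_r).measurableSet).2
    (Filter.Eventually.of_forall fun z => z.2)

theorem lintegral_nu {f : G → ENNReal} (hf : Measurable f) :
    ∫⁻ x, f x ∂(hs.nu μ) = ∫⁻ a, ∫⁻ x, f x ∂(hs.lam a) ∂μ :=
  Measure.lintegral_bind hs.measurable_lam.aemeasurable hf.aemeasurable

theorem quasiMeasurePreserving_r : Measure.QuasiMeasurePreserving r (hs.nu μ) μ := by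
  refine ⟨measurable_r, Measure.AbsolutelyContinuous.mk fun s hs' h0 => ?_⟩
  rw [Measure.map_apply measurable_r hs', nu, Measure.bind_apply (measurable_r hs')
    hs.measurable_lam.aemeasurable]
  refine (lintegral_congr_ae (g := fun _ => 0) ?_).trans lintegral_zero
  filter_upwards [measure_eq_zero_iff_ae_notMem.1 h0] with a ha
  refine measure_eq_zero_iff_ae_notMem.2 ?_
  filter_upwards [hs.ae_lam a] with x hx
  rwa [Set.mem_preimage, hx]

/-- The full support of λᵃ makes it nonzero, so a property of r(x), constant on each fibre, cannot
fail at a while holding λᵃ-a.e. -/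
theorem ae_of_ae_r {p : G0 G → Prop} (h : ∀ᵐ x ∂(hs.nu μ), p (r x)) : ∀ᵐ a ∂μ, p a := by
  filter_upwards [Measure.ae_ae_of_ae_bind hs.measurable_lam.aemeasurable h] with a ha
  have h1 : ∀ᵐ z : RFiber a ∂(hs.measure a), p a := by
    filter_upwards [ae_of_ae_map measurable_subtype_coe.aemeasurable ha] with z hz
    rwa [z.2] at hz
  have := hs.full_support a
  have : (hs.measure a) Set.univ ≠ 0 :=
    (isOpen_univ.measure_pos _ ⟨⟨a.1, r_unit a⟩, trivial⟩).ne'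
  by_contra hp
  exact this (by simpa [hp, ae_iff] using h1)

theorem lintegral_nu_mul_le {f : G → ENNReal} (hf : Measurable f) {C : ENNReal}
    (hC : ∀ a, ∫⁻ x, f x ∂(hs.lam a) ≤ C) {g : G0 G → ENNReal} (hg : AEMeasurable g μ) :
    ∫⁻ x, f x * g (r x) ∂(hs.nu μ) ≤ C * ∫⁻ a, g a ∂μ := by
  have h1 : ∀ᵐ x ∂(hs.nu μ), f x * g (r x) = f x * hg.mk g (r x) := by
    filter_upwards [(hs.quasiMeasurePreserving_r μ).ae hg.ae_eq_mk] with x hx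
    rw [hx]
  rw [lintegral_congr_ae h1, lintegral_congr_ae hg.ae_eq_mk,
    hs.lintegral_nu μ (f := fun x => f x * hg.mk g (r x))
      (hf.mul (hg.measurable_mk.comp measurable_r)),
    ← lintegral_const_mul _ hg.measurable_mk]
  refine lintegral_mono fun a => ?_
  have h2 : ∀ᵐ x ∂(hs.lam a), f x * hg.mk g (r x) = f x * hg.mk g a := by
    filter_upwards [hs.ae_lam a] with x hx
    rw [hx]
  rw [lintegral_congr_ae h2, lintegral_mul_const _ hf]
  exact mul_le_mul_left (hC a) _

/-- Needed for the Radon-Nikodym derivative δ. The sets V_n ∩ r⁻¹{a | λᵃ(V_n) ≤ k} cover G and have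
finite ν-measure. -/
instance sigmaFinite_nu [IsFiniteMeasure μ] : SigmaFinite (hs.nu μ) := by
  obtain ⟨V, hV, hcov⟩ := exists_chart_cover G
  have hm : ∀ n, Measurable fun a => hs.lam a (V n) := fun n => hs.measurable_lam_apply_chart (hV n)
  let S : ℕ × ℕ → Set G := fun p => V p.1 ∩ r ⁻¹' {a | hs.lam a (V p.1) ≤ p.2}
  have hSr : ∀ p : ℕ × ℕ, MeasurableSet (r ⁻¹' {a : G0 G | hs.lam a (V p.1) ≤ p.2}) := fun p =>
    measurable_r (measurableSet_le (hm p.1) measurable_const)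
  have hS : ∀ p, MeasurableSet (S p) := fun p => (hV p.1).1.measurableSet.inter (hSr p)
  refine ⟨⟨⟨fun n => S n.unpair, fun _ => trivial, fun n => ?_, ?_⟩⟩⟩
  · rw [nu, Measure.bind_apply (hS _) hs.measurable_lam.aemeasurable]
    refine (lintegral_mono (g := fun _ => ((n.unpair.2 : ℕ) : ENNReal)) fun a => ?_).trans_lt ?_
    · by_cases h : hs.lam a (V n.unpair.1) ≤ (n.unpair.2 : ℕ)
      · exact (measure_mono Set.inter_subset_left).trans h
      · refine le_of_eq_of_le (measure_eq_zero_iff_ae_notMem.2 ?_) zero_le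
        filter_upwards [hs.ae_lam a] with x hx hxS
        have := hxS.2
        simp only [Set.mem_preimage, hx] at this
        exact h this
    · rw [lintegral_const]
      exact ENNReal.mul_lt_top (ENNReal.natCast_lt_top _) (measure_lt_top _ _)
  · refine Set.eq_univ_of_forall fun x => ?_
    obtain ⟨n, hn⟩ := Set.mem_iUnion.1 (hcov.symm ▸ Set.mem_univ x : x ∈ ⋃ n, V n)
    obtain ⟨k, hk⟩ := ENNReal.exists_nat_gt (hs.lam_apply_open_lt_top (r x) (hV n)).ne
    refine Set.mem_iUnion.2 ⟨Nat.pair n k, ?_⟩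
    rw [Nat.unpair_pair]
    exact ⟨hn, hk.le⟩

variable (G) in
/-- The inverse map as an isomorphism of measurable spaces. -/
def invMeasurableEquiv : G ≃ᵐ G := (invHomeomorph G).toMeasurableEquiv

instance sigmaFinite_nuInv [IsFiniteMeasure μ] : SigmaFinite (hs.nuInv μ) :=
  (invMeasurableEquiv G).sigmaFinite_map

theorem measurable_modular : Measurable (hs.modular μ) := Measure.measurable_rnDeriv _ _

variable {μ}

theorem QuasiInvariant.ae_inv (hq : hs.QuasiInvariant μ) {p : G → Prop}
    (h : ∀ᵐ x ∂(hs.nu μ), p x) : ∀ᵐ x ∂(hs.nu μ), p (AlgGroupoid.inv x) :=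
  ae_of_ae_map measurable_inv.aemeasurable (hq.2.ae_le h)

theorem QuasiInvariant.quasiMeasurePreserving_d (hq : hs.QuasiInvariant μ) :
    Measure.QuasiMeasurePreserving d (hs.nu μ) μ := by
  have h : Measure.QuasiMeasurePreserving (AlgGroupoid.inv : G → G) (hs.nu μ) (hs.nu μ) :=
    ⟨measurable_inv, hq.2⟩
  have h2 := (hs.quasiMeasurePreserving_r μ).comp h
  have h3 : (r ∘ AlgGroupoid.inv : G → G0 G) = d := funext r_inv
  rwa [h3] at h2

variable [IsFiniteMeasure μ]

theorem QuasiInvariant.modular_lt_top (hq : hs.QuasiInvariant μ) :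
    ∀ᵐ x ∂(hs.nu μ), hs.modular μ x < ⊤ := hq.1.ae_le (Measure.rnDeriv_lt_top _ _)

theorem nu0_absolutelyContinuous : hs.nu0 μ ≪ hs.nu μ := withDensity_absolutelyContinuous _ _

/-- The density δ^(-1/2) vanishes only where δ = ∞, which is a ν-null set. -/
theorem QuasiInvariant.nu_absolutelyContinuous_nu0 (hq : hs.QuasiInvariant μ) :
    hs.nu μ ≪ hs.nu0 μ := by
  refine withDensity_absolutelyContinuous' ((hs.measurable_modular μ).pow_const _).aemeasurable ?_
  filter_upwards [hq.modular_lt_top] with x hx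
  simp [ENNReal.rpow_eq_zero_iff, hx.ne]

/-- The Cauchy-Schwarz estimate behind the boundedness of integrated representations. -/
theorem QuasiInvariant.lintegral_nu0_le (hq : hs.QuasiInvariant μ) {f : G → ENNReal}
    (hf : Measurable f) {C : ENNReal} (hC : ∀ a, ∫⁻ x, f x ∂(hs.lam a) ≤ C)
    (hC' : ∀ a, ∫⁻ x, f (AlgGroupoid.inv x) ∂(hs.lam a) ≤ C) {A B : G0 G → ENNReal}
    (hA : AEMeasurable A μ) (hB : AEMeasurable B μ) :
    ∫⁻ x, f x * (A (d x) * B (r x)) ∂(hs.nu0 μ) ≤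
      C * ((∫⁻ a, A a ^ 2 ∂μ) ^ (1 / 2 : ℝ) * (∫⁻ a, B a ^ 2 ∂μ) ^ (1 / 2 : ℝ)) := by
  have hδ := hs.measurable_modular μ
  have hAd := hA.comp_quasiMeasurePreserving hq.quasiMeasurePreserving_d
  have hBr := hB.comp_quasiMeasurePreserving (hs.quasiMeasurePreserving_r μ)
  have hsq : ∀ t : ENNReal, t ^ (1 / 2 : ℝ) * t ^ (1 / 2 : ℝ) = t := fun t => by
    rw [← ENNReal.rpow_add_of_nonneg _ _ (by norm_num) (by norm_num)]
    norm_num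
  have h2 : ∀ t : ENNReal, (t ^ (1 / 2 : ℝ)) ^ (2 : ℝ) = t := fun t => by
    rw [← ENNReal.rpow_mul]; norm_num
  -- The whole density goes with A ∘ d: squaring turns δ^(-1/2) into δ⁻¹, which converts ν into ν⁻¹,
  -- and inversion then turns A ∘ d into A ∘ r.
  let u : G → ENNReal := fun x => f x ^ (1 / 2 : ℝ) * (A (d x) * hs.modular μ x ^ (-(1 / 2) : ℝ))
  let w : G → ENNReal := fun x => f x ^ (1 / 2 : ℝ) * B (r x)
  have hu : ∫⁻ x, u x ^ (2 : ℝ) ∂(hs.nu μ) ≤ C * ∫⁻ a, A a ^ 2 ∂μ := by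
    have e : ∀ x, u x ^ (2 : ℝ) = f x * A (d x) ^ 2 * (hs.modular μ x)⁻¹ := fun x => by
      simp only [u]
      rw [ENNReal.mul_rpow_of_nonneg _ _ zero_le_two, ENNReal.mul_rpow_of_nonneg _ _ zero_le_two,
        h2, ← ENNReal.rpow_mul, ← ENNReal.rpow_neg_one, ENNReal.rpow_two, mul_assoc]
      norm_num
    simp only [e]
    calc _ = ∫⁻ x, f x * A (d x) ^ 2 * (hs.modular μ x)⁻¹
          ∂((hs.nuInv μ).withDensity (hs.modular μ)) := by
          rw [modular, Measure.withDensity_rnDeriv_eq _ _ hq.1]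
      _ ≤ ∫⁻ x, hs.modular μ x * (f x * A (d x) ^ 2 * (hs.modular μ x)⁻¹) ∂(hs.nuInv μ) :=
          lintegral_withDensity_le_lintegral_mul _ hδ _
      -- Only an inequality, since δ · δ⁻¹ is 0 rather than 1 where δ is 0 or ∞.
      _ ≤ ∫⁻ x, f x * A (d x) ^ 2 ∂(hs.nuInv μ) := by
          refine lintegral_mono fun x => ?_
          calc _ = f x * A (d x) ^ 2 * (hs.modular μ x * (hs.modular μ x)⁻¹) := by ring
            _ ≤ f x * A (d x) ^ 2 * 1 := mul_le_mul_right (ENNReal.mul_inv_le_one _) _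
            _ = _ := mul_one _
      _ = ∫⁻ x, f (AlgGroupoid.inv x) * A (r x) ^ 2 ∂(hs.nu μ) := by
          refine (lintegral_map_equiv _ (invMeasurableEquiv G)).trans ?_
          refine lintegral_congr fun x => ?_
          change f (AlgGroupoid.inv x) * A (d (AlgGroupoid.inv x)) ^ 2 = _
          rw [d_inv]
      _ ≤ _ := hs.lintegral_nu_mul_le μ (hf.comp measurable_inv) hC' (hA.pow_const 2)
  have hw : ∫⁻ x, w x ^ (2 : ℝ) ∂(hs.nu μ) ≤ C * ∫⁻ a, B a ^ 2 ∂μ := by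
    have e : ∀ x, w x ^ (2 : ℝ) = f x * B (r x) ^ 2 := fun x => by
      simp only [w]
      rw [ENNReal.mul_rpow_of_nonneg _ _ zero_le_two, h2, ENNReal.rpow_two]
    simp only [e]
    exact hs.lintegral_nu_mul_le μ hf hC (hB.pow_const 2)
  have hum : AEMeasurable u (hs.nu μ) :=
    (hf.pow_const _).aemeasurable.mul (hAd.mul (hδ.pow_const _).aemeasurable)
  have hwm : AEMeasurable w (hs.nu μ) := (hf.pow_const _).aemeasurable.mul hBr
  calc _ ≤ ∫⁻ x, hs.modular μ x ^ (-(1 / 2) : ℝ) * (f x * (A (d x) * B (r x))) ∂(hs.nu μ) :=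
        lintegral_withDensity_le_lintegral_mul _ (hδ.pow_const _) _
    _ = ∫⁻ x, (u * w) x ∂(hs.nu μ) := by
        refine lintegral_congr fun x => ?_
        simp only [Pi.mul_apply, u, w]
        conv_lhs => rw [← hsq (f x)]
        ring
    _ ≤ (∫⁻ x, u x ^ (2 : ℝ) ∂(hs.nu μ)) ^ (1 / 2 : ℝ) *
          (∫⁻ x, w x ^ (2 : ℝ) ∂(hs.nu μ)) ^ (1 / 2 : ℝ) :=
        ENNReal.lintegral_mul_le_Lp_mul_Lq _ Real.HolderConjugate.two_two hum hwm
    _ ≤ (C * ∫⁻ a, A a ^ 2 ∂μ) ^ (1 / 2 : ℝ) * (C * ∫⁻ a, B a ^ 2 ∂μ) ^ (1 / 2 : ℝ) := by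
        gcongr
    _ = _ := by
        rw [ENNReal.mul_rpow_of_nonneg _ _ (by norm_num), ENNReal.mul_rpow_of_nonneg _ _ (by norm_num)]
        conv_rhs => rw [← hsq C]
        ring

end HaarSystem

end LCGroupoid

/-! ### Integrated operators and the elements of C⋆(G) given by C_c(G) -/

namespace LCGroupoid

/-- A bounded sesquilinear form on a complete seminormed inner product space comes from an operator
on the associated Hilbert space. -/
theorem exists_operator_of_form {S : Type*} [SeminormedAddCommGroup S] [InnerProductSpace ℂ S]
    [CompleteSpace S] (β : S →ₗ⋆[ℂ] S →ₗ[ℂ] ℂ) (C : ℝ) (hC : 0 ≤ C)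
    (hβ : ∀ η ξ, ‖β η ξ‖ ≤ C * ‖η‖ * ‖ξ‖) :
    ∃ T : SeparationQuotient S →L[ℂ] SeparationQuotient S, ‖T‖ ≤ C ∧
      ∀ ξ η : S, Inner.inner ℂ (SeparationQuotient.mk η) (T (SeparationQuotient.mk ξ)) = β η ξ := by
  -- A linear section of the quotient map transports the form to the quotient; the choice is
  -- harmless because the bound makes β vanish on null vectors.
  let out := SeparationQuotient.outCLM ℂ S
  have hmk : ∀ v, SeparationQuotient.mk (out v) = v := SeparationQuotient.mk_outCLM ℂ
  have hn : ∀ v, ‖out v‖ = ‖v‖ := fun v => by rw [← SeparationQuotient.norm_mk, hmk]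
  let B := LinearMap.mkContinuous₂ (LinearMap.mk₂'ₛₗ (starRingEnd ℂ) (RingHom.id ℂ)
    (fun v w => β (out v) (out w)) (by simp) (by simp) (by simp) (by simp)) C
    (fun v w => by simpa [hn] using hβ (out v) (out w))
  have hB : ∀ v w, B v w = β (out v) (out w) := fun v w => rfl
  -- The Riesz operator of B stands in the first slot of the inner product; the adjoint moves it to
  -- the second.
  let T := ContinuousLinearMap.adjoint (InnerProductSpace.continuousLinearMapOfBilin B)
  have hT : ∀ v w, Inner.inner ℂ v (T w) = B v w := fun v w => by
    rw [ContinuousLinearMap.adjoint_inner_right,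
      InnerProductSpace.continuousLinearMapOfBilin_apply]
  refine ⟨T, T.opNorm_le_bound hC fun w => ?_, fun ξ η => ?_⟩
  · by_cases h0 : ‖T w‖ = 0
    · rw [h0]; positivity
    · have h1 : ‖T w‖ * ‖T w‖ ≤ (C * ‖w‖) * ‖T w‖ := by
        have h2 := hβ (out (T w)) (out w)
        rw [← hB, ← hT, hn, hn, inner_self_eq_norm_sq_to_K] at h2
        have h3 : ‖((‖T w‖ : ℝ) : ℂ) ^ 2‖ = ‖T w‖ * ‖T w‖ := by
          rw [norm_pow, Complex.norm_real, norm_norm, sq]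
        have h4 : ‖T w‖ * ‖T w‖ ≤ C * ‖T w‖ * ‖w‖ := h3 ▸ h2
        linarith
      exact le_of_mul_le_mul_right h1 ((norm_nonneg _).lt_of_ne' h0)
  · rw [hT, hB]
    have h1 : ‖out (SeparationQuotient.mk ξ) - ξ‖ = 0 := by
      rw [← SeparationQuotient.norm_mk, SeparationQuotient.mk_sub, hmk, sub_self, norm_zero]
    have h2 : ‖out (SeparationQuotient.mk η) - η‖ = 0 := by
      rw [← SeparationQuotient.norm_mk, SeparationQuotient.mk_sub, hmk, sub_self, norm_zero]
    have h3 : ∀ ζ, β (out (SeparationQuotient.mk η) - η) ζ = 0 := fun ζ =>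
      norm_le_zero_iff.1 ((hβ _ _).trans (by rw [h2]; simp))
    have h4 : β η (out (SeparationQuotient.mk ξ) - ξ) = 0 :=
      norm_le_zero_iff.1 ((hβ _ _).trans (by rw [h1]; simp))
    have h5 := h3 (out (SeparationQuotient.mk ξ))
    rw [map_sub, LinearMap.sub_apply, sub_eq_zero] at h5
    rw [map_sub, sub_eq_zero] at h4
    rw [h5, h4]

namespace HilbertBundle.SqInt

variable {X : Type u} [MeasurableSpace X] {μ : Measure X} {E : HilbertBundle.{u, v} X μ}

theorem aemeasurable_enorm (ξ : E.SqInt) : AEMeasurable (fun a => ‖ξ a‖ₑ) μ := by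
  simp only [← ofReal_norm]
  exact (E.norm_meas _ ξ.mem_meas).ennreal_ofReal

theorem lintegral_enorm_sq (ξ : E.SqInt) :
    (∫⁻ a, ‖ξ a‖ₑ ^ 2 ∂μ) ^ (1 / 2 : ℝ) = ENNReal.ofReal ‖ξ‖ := by
  have h : ∫⁻ a, ‖ξ a‖ₑ ^ 2 ∂μ = ENNReal.ofReal (‖ξ‖ ^ 2) := by
    rw [norm_sq, ofReal_integral_eq_lintegral_ofReal ξ.integrable_norm_sq
      (Filter.Eventually.of_forall fun a => by positivity)]
    refine lintegral_congr fun a => ?_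
    rw [ENNReal.ofReal_pow (norm_nonneg _), ofReal_norm]
  rw [h, ENNReal.ofReal_rpow_of_nonneg (by positivity) (by norm_num), ← Real.sqrt_eq_rpow,
    Real.sqrt_sq (norm_nonneg _)]

end HilbertBundle.SqInt

variable {G : Type u} [TopologicalSpace G] [MeasurableSpace G] [BorelSpace G]
  [LocallyCompactGroupoid G] {hs : HaarSystem G}

namespace Representation

variable (L : Representation.{u, v} hs)

theorem ae_unitary : ∀ᵐ x ∂(hs.nu L.μ), Isometry (L.op x) ∧ Function.Bijective (L.op x) := by
  have hU : ∀ᵐ a ∂L.μ, a ∈ L.U := mem_ae_iff.2 L.conull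
  filter_upwards [L.unitary, (hs.quasiMeasurePreserving_r L.μ).ae hU,
    L.quasiInvariant.quasiMeasurePreserving_d.ae hU] with x h1 h2 h3 using h1 h2 h3

/-- The constant bounds the fibre integrals of |f| and of |f ∘ inv|, hence does not depend on L.
Unitarity of L(x) reduces the integrand to |f| ‖ξ(d(x))‖ ‖η(r(x))‖. -/
theorem exists_integrand_bound {f : G → ℂ} (hf : f ∈ Cc G) : ∃ C : NNReal,
    ∀ (L : Representation.{u, v} hs) (ξ η : L.bundle.SqInt),
      Integrable (fun x => f x * Inner.inner ℂ (η (r x)) (L.op x (ξ (d x)))) (hs.nu0 L.μ) ∧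
      ‖∫ x, f x * Inner.inner ℂ (η (r x)) (L.op x (ξ (d x))) ∂(hs.nu0 L.μ)‖ ≤
        C * ‖η‖ * ‖ξ‖ := by
  obtain ⟨C₁, hC₁⟩ := hs.exists_lintegral_le hf
  obtain ⟨C₂, hC₂⟩ := hs.exists_lintegral_le (comp_inv_mem_Cc hf)
  have hfm := measurable_of_mem_Cc hf
  refine ⟨max C₁ C₂, fun L ξ η => ?_⟩
  have hm : AEStronglyMeasurable
      (fun x => f x * Inner.inner ℂ (η (r x)) (L.op x (ξ (d x)))) (hs.nu0 L.μ) :=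
    (hfm.aemeasurable.mul
      ((L.coeff_meas ξ η).mono_ac (hs.nu0_absolutelyContinuous))).aestronglyMeasurable
  have hle : ∫⁻ x, ‖f x * Inner.inner ℂ (η (r x)) (L.op x (ξ (d x)))‖ₑ ∂(hs.nu0 L.μ) ≤
      ENNReal.ofReal ((max C₁ C₂ : NNReal) * ‖η‖ * ‖ξ‖) := by
    calc _ ≤ ∫⁻ x, ‖f x‖ₑ * (‖ξ (d x)‖ₑ * ‖η (r x)‖ₑ) ∂(hs.nu0 L.μ) := by
          refine lintegral_mono_ae ?_
          filter_upwards [hs.nu0_absolutelyContinuous.ae_le L.ae_unitary] with x hx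
          rw [enorm_mul]
          gcongr
          rw [mul_comm, ← ofReal_norm, ← ofReal_norm, ← ofReal_norm,
            ← ENNReal.ofReal_mul (norm_nonneg _)]
          refine ENNReal.ofReal_le_ofReal ((norm_inner_le_norm _ _).trans_eq ?_)
          rw [hx.1.norm_map_of_map_zero (map_zero _)]
      _ ≤ _ := HaarSystem.QuasiInvariant.lintegral_nu0_le hs L.quasiInvariant hfm.enorm
          (C := (max C₁ C₂ : NNReal)) (A := fun a => ‖ξ a‖ₑ) (B := fun a => ‖η a‖ₑ)
          (fun a => (hC₁ a).trans (by simp)) (fun a => (hC₂ a).trans (by simp))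
          ξ.aemeasurable_enorm η.aemeasurable_enorm
      _ = _ := by
          rw [ξ.lintegral_enorm_sq, η.lintegral_enorm_sq, mul_assoc, ENNReal.ofReal_mul (by positivity),
            ENNReal.ofReal_mul (norm_nonneg _), mul_comm (ENNReal.ofReal ‖ξ‖),
            ENNReal.ofReal_coe_nnreal]
  refine ⟨⟨hm, hle.trans_lt ENNReal.ofReal_lt_top⟩, ?_⟩
  refine (ENNReal.ofReal_le_ofReal_iff (by positivity)).1 ?_
  rw [ofReal_norm]
  exact (enorm_integral_le_lintegral_enorm _).trans hle

/-- Uniformity of C in L is the point: it makes the family of all π_L(f) bounded. -/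
theorem exists_isIntegrated {f : G → ℂ} (hf : f ∈ Cc G) : ∃ C : NNReal,
    ∀ L : Representation.{u, v} hs, ∃ T, ‖T‖ ≤ C ∧ L.IsIntegrated f T := by
  obtain ⟨C, hC⟩ := exists_integrand_bound (hs := hs) hf
  refine ⟨C, fun L => ?_⟩
  have hi := fun ξ η => (hC L ξ η).1
  let β : L.bundle.SqInt →ₗ⋆[ℂ] L.bundle.SqInt →ₗ[ℂ] ℂ :=
    LinearMap.mk₂'ₛₗ (starRingEnd ℂ) (RingHom.id ℂ)
      (fun η ξ => ∫ x, f x * Inner.inner ℂ (η (r x)) (L.op x (ξ (d x))) ∂(hs.nu0 L.μ))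
      (fun η η' ξ => by
        rw [← integral_add (hi _ _) (hi _ _)]
        simp only [HilbertBundle.SqInt.add_apply, inner_add_left, mul_add])
      (fun c η ξ => by
        rw [smul_eq_mul, ← integral_const_mul]
        simp only [HilbertBundle.SqInt.smul_apply, inner_smul_left, mul_left_comm])
      (fun η ξ ξ' => by
        rw [← integral_add (hi _ _) (hi _ _)]
        simp only [HilbertBundle.SqInt.add_apply, map_add, inner_add_right, mul_add])
      (fun c η ξ => by
        rw [smul_eq_mul, ← integral_const_mul]
        simp only [HilbertBundle.SqInt.smul_apply, map_smul, inner_smul_right, mul_left_comm,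
          RingHom.id_apply])
  obtain ⟨T, hT, hT'⟩ := exists_operator_of_form β C C.2 fun η ξ => (hC L ξ η).2
  exact ⟨T, hT, fun ξ η => ⟨hi ξ η, hT' ξ η⟩⟩

end Representation

/-- Every function in `C_c(G)` defines an element of `C⋆(G)`. -/
theorem exists_cstar {f : G → ℂ} (hf : f ∈ Cc G) :
    ∃ a : CStar.{u, v} hs, ∀ L : Representation.{u, v} hs, L.IsIntegrated f (L.pi a) := by
  obtain ⟨C, hC⟩ := Representation.exists_isIntegrated (hs := hs) hf
  choose T hT hT' using hC
  have hmem : Memℓp T ⊤ := memℓp_infty ⟨C, by rintro _ ⟨L, rfl⟩; exact hT L⟩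
  let F : OperatorFamilies.{u, v} hs := (⟨T, hmem⟩ : lp _ ⊤)
  have hF : F ∈ cstarSubalgebra.{u, v} hs :=
    NonUnitalStarSubalgebra.le_topologicalClosure _
      (NonUnitalStarAlgebra.subset_adjoin ℂ _ ⟨f, hf, hT'⟩)
  exact ⟨(⟨F, hF⟩ : cstarSubalgebra.{u, v} hs), hT'⟩

end LCGroupoid

/-! ### Pointwise properties of square integrable sections and of subbundles -/

namespace LCGroupoid
namespace HilbertBundle

variable {X : Type u} [MeasurableSpace X] {μ : Measure X} {E : HilbertBundle.{u, v} X μ}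

theorem smul_mem_meas {φ : X → ℂ} (hφ : AEMeasurable φ μ) {ξ : ∀ a, E.Fiber a} (hξ : ξ ∈ E.meas) :
    (fun a => φ a • ξ a) ∈ E.meas := by
  refine E.mem_meas _ fun ζ hζ => ?_
  simp only [inner_smul_right]
  exact hφ.mul (E.aemeasurable_inner hζ hξ)

theorem span_range_eq_of_smul {V : Type*} [AddCommGroup V] [Module ℂ V] {v w : ℕ → V} {c : ℕ → ℂ}
    (hc : ∀ n, c n ≠ 0) (h : ∀ n, w n = c n • v n) :
    Submodule.span ℂ (Set.range w) = Submodule.span ℂ (Set.range v) := by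
  refine le_antisymm (Submodule.span_le.2 ?_) (Submodule.span_le.2 ?_)
  · rintro _ ⟨n, rfl⟩
    exact h n ▸ Submodule.smul_mem _ _ (Submodule.subset_span ⟨n, rfl⟩)
  · rintro _ ⟨n, rfl⟩
    rw [← inv_smul_smul₀ (hc n) (v n), ← h n]
    exact Submodule.smul_mem _ _ (Submodule.subset_span ⟨n, rfl⟩)

/-- A sequence of measurable sections can be rescaled to be square integrable. -/
theorem exists_sqInt_span_eq [IsFiniteMeasure μ] (ξ : ℕ → ∀ a, E.Fiber a)
    (hξ : ∀ n, ξ n ∈ E.meas) : ∃ e : ℕ → E.SqInt, ∀ a,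
      Submodule.span ℂ (Set.range fun n => e n a) =
        Submodule.span ℂ (Set.range fun n => ξ n a) := by
  -- Dividing by 1 + ‖ξ_n(a)‖ bounds the norm by 1, which is square integrable for a finite measure,
  -- and never changes the span.
  let c : ℕ → X → ℝ := fun n a => (1 + ‖ξ n a‖)⁻¹
  have hc : ∀ n a, 0 < c n a := fun n a => by positivity
  have hcm : ∀ n, AEMeasurable (c n) μ := fun n => ((E.norm_meas _ (hξ n)).const_add 1).inv
  have hm : ∀ n, (fun a => ((c n a : ℝ) : ℂ) • ξ n a) ∈ E.meas := fun n =>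
    smul_mem_meas (Complex.measurable_ofReal.comp_aemeasurable (hcm n)) (hξ n)
  have hi : ∀ n, Integrable (fun a => ‖((c n a : ℝ) : ℂ) • ξ n a‖ ^ 2) μ := fun n => by
    refine (integrable_const (1 : ℝ)).mono' ((E.norm_meas _ (hm n)).pow_const 2).aestronglyMeasurable
      (Filter.Eventually.of_forall fun a => ?_)
    rw [norm_smul, Complex.norm_real, Real.norm_of_nonneg (hc n a).le,
      Real.norm_of_nonneg (by positivity)]
    refine pow_le_one₀ (mul_nonneg (hc n a).le (norm_nonneg _)) ?_
    rw [inv_mul_le_one₀ (by positivity)]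
    linarith
  refine ⟨fun n => SqInt.of _ (hm n) (hi n), fun a => ?_⟩
  exact span_range_eq_of_smul (c := fun n => ((c n a : ℝ) : ℂ))
    (fun n => Complex.ofReal_ne_zero.2 (hc n a).ne') fun n => rfl

theorem exists_sqInt_fundamental [IsFiniteMeasure μ] (E : HilbertBundle.{u, v} X μ) :
    ∃ e : ℕ → E.SqInt, ∀ a,
      (Submodule.span ℂ (Set.range fun n => e n a)).topologicalClosure = ⊤ := by
  obtain ⟨ξ, hξ, hspan⟩ := E.exists_fundamental
  obtain ⟨e, he⟩ := exists_sqInt_span_eq ξ hξ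
  exact ⟨e, fun a => by rw [he, hspan]⟩

namespace SqInt

theorem cls_eq_iff {ξ η : E.SqInt} : ξ.cls = η.cls ↔ ∀ᵐ a ∂μ, ξ a = η a := by
  rw [SeparationQuotient.mk_eq_mk, Metric.inseparable_iff, dist_eq_norm,
    ← sq_eq_zero_iff, norm_sq, integral_eq_zero_iff_of_nonneg (fun a => by positivity)
    (ξ - η).integrable_norm_sq]
  refine Filter.eventually_congr (Filter.Eventually.of_forall fun a => ?_)
  simp [sub_apply, sub_eq_zero]

/-- The restriction of a section to a measurable set, extended by zero. -/
noncomputable def restrict (s : Set X) (hs : MeasurableSet s) (ξ : E.SqInt) : E.SqInt :=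
  of (fun a => s.indicator (1 : X → ℂ) a • ξ a)
    (smul_mem_meas ((measurable_const.indicator hs).aemeasurable) ξ.mem_meas) (by
      refine (ξ.integrable_norm_sq.indicator hs).congr (Filter.Eventually.of_forall fun a => ?_)
      by_cases h : a ∈ s <;> simp [h])

theorem restrict_apply_mem {s : Set X} (hs : MeasurableSet s) (ξ : E.SqInt) {a : X} (h : a ∈ s) :
    ξ.restrict s hs a = ξ a := by
  simp [restrict, of_apply, h]

theorem restrict_apply_notMem {s : Set X} (hs : MeasurableSet s) (ξ : E.SqInt) {a : X}
    (h : a ∉ s) : ξ.restrict s hs a = 0 := by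
  simp [restrict, of_apply, h]

/-- The inner product with the restriction to s is the integral of the pointwise inner product over
s. This is the device that turns global orthogonality into pointwise orthogonality. -/
theorem ae_inner_eq_zero {ξ η : E.SqInt}
    (h : ∀ s (hs : MeasurableSet s), Inner.inner ℂ (η.restrict s hs).cls ξ.cls = 0) :
    ∀ᵐ a ∂μ, Inner.inner ℂ (η a) (ξ a) = 0 := by
  refine (integrable_inner η ξ).ae_eq_zero_of_forall_setIntegral_eq_zero fun s hs _ => ?_
  rw [← h s hs, SeparationQuotient.inner_mk_mk, inner_def, ← integral_indicator hs]
  refine integral_congr_ae (Filter.Eventually.of_forall fun a => ?_)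
  by_cases ha : a ∈ s
  · simp only [Set.indicator_of_mem ha, restrict_apply_mem hs η ha]
  · simp only [Set.indicator_of_notMem ha, restrict_apply_notMem hs η ha, inner_zero_left]

end SqInt

namespace Subbundle

variable (M : E.Subbundle)

theorem isClosed_space (a : X) : IsClosed (M.space a : Set (E.Fiber a)) := by
  obtain ⟨ξ, -, h⟩ := M.exists_fundamental
  rw [← h a]
  exact Submodule.isClosed_topologicalClosure _

theorem exists_sqInt [IsFiniteMeasure μ] : ∃ e : ℕ → E.SqInt,
    (∀ a, (Submodule.span ℂ (Set.range fun n => e n a)).topologicalClosure = M.space a) ∧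
      ∀ n a, e n a ∈ M.space a := by
  obtain ⟨ξ, hξ, hspan⟩ := M.exists_fundamental
  obtain ⟨e, he⟩ := exists_sqInt_span_eq ξ hξ
  have h : ∀ a, (Submodule.span ℂ (Set.range fun n => e n a)).topologicalClosure = M.space a :=
    fun a => by rw [he, hspan]
  exact ⟨e, h, fun n a => h a ▸
    Submodule.le_topologicalClosure _ (Submodule.subset_span ⟨n, rfl⟩)⟩

theorem cls_mem_l2 {ξ : E.SqInt} : ξ.cls ∈ M.l2 ↔ ∀ᵐ a ∂μ, ξ a ∈ M.space a := by
  constructor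
  · rintro ⟨η, h, hη⟩
    filter_upwards [SqInt.cls_eq_iff.1 h, hη] with a h1 h2
    rwa [← h1]
  · exact fun h => ⟨ξ, rfl, h⟩

theorem isClosed_l2 : IsClosed (M.l2 : Set E.L2) := by
  refine isClosed_of_closure_subset fun z hz => ?_
  obtain ⟨ξ, rfl⟩ := SeparationQuotient.surjective_mk z
  have hk : ∀ k : ℕ, ∃ η : E.SqInt, (∀ᵐ a ∂μ, η a ∈ M.space a) ∧ ‖ξ - η‖ < 1 / ((k : ℝ) + 1) := by
    intro k
    obtain ⟨y, hy, hd⟩ := Metric.mem_closure_iff.1 hz (1 / ((k : ℝ) + 1)) (by positivity)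
    obtain ⟨η, rfl, hη⟩ := hy
    refine ⟨η, hη, ?_⟩
    rwa [SeparationQuotient.dist_mk, dist_eq_norm] at hd
  choose η hη hd using hk
  have hm : ∀ k, AEMeasurable (fun a => ‖(ξ - η k) a‖ₑ) μ := fun k => (ξ - η k).aemeasurable_enorm
  -- The infimum over all k is dominated by each term, whose integral is at most 1/(k+1)². It is
  -- thus zero a.e., which puts ξ(a) in the closure of M_a without passing to a subsequence.
  have hI : ∫⁻ a, ⨅ k, ‖(ξ - η k) a‖ₑ ^ 2 ∂μ = 0 := by
    have hle : ∀ k : ℕ, ∫⁻ a, ⨅ k, ‖(ξ - η k) a‖ₑ ^ 2 ∂μ ≤ ENNReal.ofReal ((1 / ((k : ℝ) + 1)) ^ 2) := by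
      intro k
      calc _ ≤ ∫⁻ a, ‖(ξ - η k) a‖ₑ ^ 2 ∂μ := lintegral_mono fun a => iInf_le _ k
        _ = ENNReal.ofReal (‖ξ - η k‖ ^ 2) := by
          rw [SqInt.norm_sq, ofReal_integral_eq_lintegral_ofReal (ξ - η k).integrable_norm_sq
            (Filter.Eventually.of_forall fun a => by positivity)]
          refine lintegral_congr fun a => ?_
          rw [ENNReal.ofReal_pow (norm_nonneg _), ofReal_norm]
        _ ≤ _ := ENNReal.ofReal_le_ofReal (pow_le_pow_left₀ (norm_nonneg _) (hd k).le 2)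
    have hlim : Filter.Tendsto (fun k : ℕ => ENNReal.ofReal ((1 / ((k : ℝ) + 1)) ^ 2)) Filter.atTop
        (𝓝 0) := by
      have := ENNReal.tendsto_ofReal ((tendsto_one_div_add_atTop_nhds_zero_nat (𝕜 := ℝ)).pow 2)
      simpa using this
    exact le_antisymm (ge_of_tendsto' hlim hle) zero_le
  rw [lintegral_eq_zero_iff' (AEMeasurable.iInf fun k => (hm k).pow_const 2)] at hI
  refine M.cls_mem_l2.2 ?_
  filter_upwards [hI, ae_all_iff.2 hη] with a h0 ha
  have hcl : ξ a ∈ closure (M.space a : Set (E.Fiber a)) := by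
    refine EMetric.mem_closure_iff.2 fun ε hε => ?_
    have h1 : ⨅ k, ‖(ξ - η k) a‖ₑ ^ 2 < ε ^ 2 := by
      rw [show ⨅ k, ‖(ξ - η k) a‖ₑ ^ 2 = 0 from h0]
      exact ENNReal.pow_pos hε 2
    obtain ⟨k, hk⟩ := iInf_lt_iff.1 h1
    refine ⟨η k a, ha k, ?_⟩
    rw [edist_eq_enorm_sub]
    exact lt_of_pow_lt_pow_left' 2 hk
  rwa [(M.isClosed_space a).closure_eq] at hcl

/-- M(μ) is stable under restriction to measurable sets, so orthogonality localises; a countable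
total sequence in M keeps the exceptional set null. -/
theorem ae_inner_eq_zero_of_forall_mem_l2 [IsFiniteMeasure μ] {η : E.SqInt}
    (h : ∀ z ∈ M.l2, Inner.inner ℂ z η.cls = 0) :
    ∀ᵐ a ∂μ, ∀ v ∈ M.space a, Inner.inner ℂ v (η a) = 0 := by
  obtain ⟨e, he, hem⟩ := M.exists_sqInt
  have h1 : ∀ n, ∀ᵐ a ∂μ, Inner.inner ℂ (e n a) (η a) = 0 := fun n => by
    refine SqInt.ae_inner_eq_zero fun s hs => h _ (M.cls_mem_l2.2 ?_)
    refine Filter.Eventually.of_forall fun a => ?_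
    by_cases ha : a ∈ s
    · rw [SqInt.restrict_apply_mem hs _ ha]
      exact hem n a
    · rw [SqInt.restrict_apply_notMem hs _ ha]
      exact Submodule.zero_mem _
  filter_upwards [ae_all_iff.2 h1] with a ha v hv
  have hle : M.space a ≤ (ℂ ∙ η a)ᗮ := by
    rw [← he a]
    refine Submodule.topologicalClosure_minimal _ (Submodule.span_le.2 ?_)
      (Submodule.isClosed_orthogonal _)
    rintro _ ⟨n, rfl⟩
    exact Submodule.mem_orthogonal_singleton_iff_inner_left.2 (ha n)
  exact Submodule.mem_orthogonal_singleton_iff_inner_left.1 (hle hv)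

theorem Nontrivial.l2_ne_bot [IsFiniteMeasure μ] {M : E.Subbundle} (hM : M.Nontrivial) :
    M.l2 ≠ ⊥ := by
  intro h
  obtain ⟨e, he, hem⟩ := M.exists_sqInt
  have h1 : ∀ n, ∀ᵐ a ∂μ, e n a = 0 := fun n => by
    have h2 : (e n).cls ∈ M.l2 := M.cls_mem_l2.2 (Filter.Eventually.of_forall fun a => hem n a)
    rw [h, Submodule.mem_bot] at h2
    exact SqInt.cls_eq_iff (η := 0).1 h2
  refine hM.1.ne' (measure_eq_zero_iff_ae_notMem.2 ?_)
  filter_upwards [ae_all_iff.2 h1] with a ha hne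
  refine hne ?_
  rw [← he a, eq_bot_iff]
  refine Submodule.topologicalClosure_minimal _ (Submodule.span_le.2 ?_) isClosed_singleton
  rintro _ ⟨n, rfl⟩
  exact ha n

theorem Nontrivial.l2_ne_top [IsFiniteMeasure μ] {M : E.Subbundle} (hM : M.Nontrivial) :
    M.l2 ≠ ⊤ := by
  intro h
  obtain ⟨e, he⟩ := E.exists_sqInt_fundamental
  have h1 : ∀ n, ∀ᵐ a ∂μ, e n a ∈ M.space a := fun n => M.cls_mem_l2.1 (h ▸ Submodule.mem_top)
  refine hM.2.ne' (measure_eq_zero_iff_ae_notMem.2 ?_)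
  filter_upwards [ae_all_iff.2 h1] with a ha hne
  refine hne ?_
  rw [eq_top_iff, ← he a]
  refine Submodule.topologicalClosure_minimal _ (Submodule.span_le.2 ?_) (M.isClosed_space a)
  rintro _ ⟨n, rfl⟩
  exact ha n

end Subbundle
end HilbertBundle
end LCGroupoid

/-! ### The correspondence between invariant subbundles and invariant subspaces -/

namespace LCGroupoid

theorem mem_of_forall_orthogonal {H : Type*} [NormedAddCommGroup H]
    [InnerProductSpace ℂ H] [CompleteSpace H] {K : Submodule ℂ H} (hK : IsClosed (K : Set H))
    {z : H} (h : ∀ w ∈ Kᗮ, Inner.inner ℂ w z = 0) : z ∈ K := by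
  have h1 : z ∈ Kᗮᗮ := (Submodule.mem_orthogonal _ _).2 h
  rwa [Submodule.orthogonal_orthogonal_eq_closure, hK.submodule_topologicalClosure_eq] at h1

/-- If two orthogonal sequences are jointly total, then the vectors orthogonal to the second lie in
the closed span of the first. -/
theorem mem_closure_span_of_orthogonal {H : Type*} [NormedAddCommGroup H] [InnerProductSpace ℂ H]
    [CompleteSpace H] {ξ η : ℕ → H} (ho : ∀ n m, Inner.inner ℂ (η n) (ξ m) = 0)
    (ht : (Submodule.span ℂ (Set.range fun n => ξ n + η n)).topologicalClosure = ⊤) {v : H}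
    (hv : ∀ n, Inner.inner ℂ (η n) v = 0) :
    v ∈ (Submodule.span ℂ (Set.range ξ)).topologicalClosure := by
  set M := (Submodule.span ℂ (Set.range ξ)).topologicalClosure with hMdef
  have hξM : ∀ n, ξ n ∈ M := fun n =>
    Submodule.le_topologicalClosure _ (Submodule.subset_span ⟨n, rfl⟩)
  have hηM : ∀ n, ∀ y ∈ M, Inner.inner ℂ (η n) y = 0 := fun n y hy => by
    have hle : M ≤ (ℂ ∙ η n)ᗮ := by
      refine Submodule.topologicalClosure_minimal _ (Submodule.span_le.2 ?_)
        (Submodule.isClosed_orthogonal _)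
      rintro _ ⟨m, rfl⟩
      exact Submodule.mem_orthogonal_singleton_iff_inner_right.2 (ho n m)
    exact Submodule.mem_orthogonal_singleton_iff_inner_right.1 (hle hy)
  -- The component z of v orthogonal to M is orthogonal to every ξ_n, and to every η_n because v and
  -- y are. Totality of the sums forces z = 0.
  obtain ⟨y, hy, z, hz, rfl⟩ := M.exists_add_mem_mem_orthogonal v
  have hz0 : z ∈ (Submodule.span ℂ (Set.range fun n => ξ n + η n))ᗮ := by
    rw [Submodule.mem_orthogonal]
    intro u hu
    refine Submodule.mem_orthogonal_singleton_iff_inner_left.1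
      ((Submodule.span_le (p := (ℂ ∙ z)ᗮ)).2 ?_ hu)
    rintro _ ⟨n, rfl⟩
    refine Submodule.mem_orthogonal_singleton_iff_inner_left.2 ?_
    have h1 := hv n
    rw [inner_add_right, hηM n y hy, zero_add] at h1
    rw [inner_add_left, (Submodule.mem_orthogonal _ _).1 hz _ (hξM n), h1, add_zero]
  rw [Submodule.topologicalClosure_eq_top_iff.1 ht, Submodule.mem_bot] at hz0
  rwa [hz0, add_zero]

theorem transport_mem {G : Type u} [TopologicalSpace G] [MeasurableSpace G]
    [LocallyCompactGroupoid G] {H : G0 G → Type v} [∀ a, NormedAddCommGroup (H a)]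
    [∀ a, InnerProductSpace ℂ (H a)] (op : ∀ x : G, H (d x) →L[ℂ] H (r x))
    (S : ∀ a, Submodule ℂ (H a)) {a b : G0 G} (x : G) (hd : d x = a) (hr : r x = b)
    (h : ∀ v ∈ S (d x), op x v ∈ S (r x)) : ∀ v ∈ S a, transport op x hd hr v ∈ S b := by
  subst hd hr
  exact h

variable {G : Type u} [TopologicalSpace G] [MeasurableSpace G] [BorelSpace G]
  [LocallyCompactGroupoid G] {hs : HaarSystem G}

namespace Representation

variable (L : Representation.{u, v} hs)

/-! ### From subbundles to subspaces -/

/-- Quasi-invariance allows the inclusion to be used at x⁻¹ for a.e. x, and L(x)L(x⁻¹) = 1 exhibits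
w as the image of L(x⁻¹)w. -/
theorem Invariant.ae_inv_mem {L : Representation.{u, v} hs} {M : L.bundle.Subbundle}
    (hM : L.Invariant M) : ∀ᵐ x ∂(hs.nu L.μ), ∀ w ∈ M.space (r x),
      ∃ v ∈ M.space (d x), L.op x v = w := by
  filter_upwards [HaarSystem.QuasiInvariant.ae_inv hs L.quasiInvariant hM, L.op_inv] with x hx hinv
    w hw
  refine ⟨_, transport_mem L.op M.space (AlgGroupoid.inv x) (d_inv x) (r_inv x) hx w hw, ?_⟩
  exact congrArg (fun T => T w) hinv.2

theorem IsIntegrated.inner_eq_zero {L : Representation.{u, v} hs} {f : G → ℂ}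
    {T : L.Space →L[ℂ] L.Space} (hT : L.IsIntegrated f T) {ξ η : L.bundle.SqInt}
    (h : ∀ᵐ x ∂(hs.nu L.μ), Inner.inner ℂ (η (r x)) (L.op x (ξ (d x))) = 0) :
    Inner.inner ℂ η.cls (T ξ.cls) = 0 := by
  rw [(hT ξ η).2]
  refine integral_eq_zero_of_ae ?_
  filter_upwards [hs.nu0_absolutelyContinuous.ae_le h] with x hx
  simp [hx]

/-- The adjoint is included because C⋆(G) is generated as a ⋆-algebra. For it, ξ(r(x)) is written as
L(x)v with v in M_{d(x)}, and unitarity moves the inner product back to d(x). -/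
theorem Invariant.l2_invariant {L : Representation.{u, v} hs} {M : L.bundle.Subbundle}
    (hM : L.Invariant M) {f : G → ℂ} {T : L.Space →L[ℂ] L.Space} (hT : L.IsIntegrated f T) :
    (∀ z ∈ M.l2, T z ∈ M.l2) ∧ ∀ z ∈ M.l2, ContinuousLinearMap.adjoint T z ∈ M.l2 := by
  have horth : ∀ η : L.bundle.SqInt, η.cls ∈ M.l2ᗮ →
      ∀ᵐ a ∂L.μ, ∀ v ∈ M.space a, Inner.inner ℂ v (η a) = 0 := fun η hη =>
    M.ae_inner_eq_zero_of_forall_mem_l2 ((Submodule.mem_orthogonal _ _).1 hη)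
  constructor
  · intro z hz
    refine mem_of_forall_orthogonal M.isClosed_l2 fun w hw => ?_
    obtain ⟨ξ, rfl⟩ := SeparationQuotient.surjective_mk z
    obtain ⟨η, rfl⟩ := SeparationQuotient.surjective_mk w
    refine hT.inner_eq_zero ?_
    filter_upwards [hM, L.quasiInvariant.quasiMeasurePreserving_d.ae (M.cls_mem_l2.1 hz),
      (hs.quasiMeasurePreserving_r L.μ).ae (horth η hw)] with x h1 h2 h3
    exact inner_eq_zero_symm.1 (h3 _ (h1 _ h2))
  · intro z hz
    refine mem_of_forall_orthogonal M.isClosed_l2 fun w hw => ?_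
    obtain ⟨ξ, rfl⟩ := SeparationQuotient.surjective_mk z
    obtain ⟨η, rfl⟩ := SeparationQuotient.surjective_mk w
    rw [ContinuousLinearMap.adjoint_inner_right, inner_eq_zero_symm]
    refine hT.inner_eq_zero ?_
    filter_upwards [hM.ae_inv_mem, (hs.quasiMeasurePreserving_r L.μ).ae (M.cls_mem_l2.1 hz),
      L.quasiInvariant.quasiMeasurePreserving_d.ae (horth η hw), L.ae_unitary] with x h1 h2 h3 h4
    obtain ⟨v, hv, hvx⟩ := h1 _ h2
    rw [← hvx]
    let U : L.bundle.Fiber (d x) →ₗᵢ[ℂ] L.bundle.Fiber (r x) :=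
      ⟨(L.op x).toLinearMap, fun v => h4.1.norm_map_of_map_zero (map_zero _) v⟩
    exact (U.inner_map_map v (η (d x))).trans (h3 v hv)

theorem pi_mem_of_forall_integrated {K : Submodule ℂ L.Space} (hK : IsClosed (K : Set L.Space))
    (h : ∀ f ∈ Cc G, ∀ T, L.IsIntegrated f T →
      (∀ z ∈ K, T z ∈ K) ∧ ∀ z ∈ K, ContinuousLinearMap.adjoint T z ∈ K)
    (a : CStar.{u, v} hs) : ∀ z ∈ K, L.pi a z ∈ K := by
  let ev : OperatorFamilies.{u, v} hs →ₗ[ℂ] (L.Space →L[ℂ] L.Space) :=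
    { toFun := fun F => F.app L, map_add' := fun _ _ => rfl, map_smul' := fun _ _ => rfl }
  have hev : Continuous ev := AddMonoidHomClass.continuous_of_bound ev 1 fun F => by
    rw [one_mul]
    exact lp.norm_apply_le_norm ENNReal.top_ne_zero (show lp _ ⊤ from F) L
  have hcl : IsClosed {F : OperatorFamilies.{u, v} hs | ∀ z ∈ K, F.app L z ∈ K} := by
    simp only [Set.ofPred_forall]
    refine isClosed_iInter fun z => isClosed_iInter fun _ => hK.preimage ?_
    exact (ContinuousLinearMap.apply ℂ L.Space z).continuous.comp hev
  refine closure_minimal (fun F hF => ?_) hcl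
    (show a.val ∈ closure (NonUnitalStarAlgebra.adjoin ℂ (integratedFamilies.{u, v} hs) : Set _)
      from (show cstarSubalgebra.{u, v} hs from a).2)
  -- Carrying F and its adjoint together is what lets the induction pass through the star operation.
  suffices key : (∀ z ∈ K, F.app L z ∈ K) ∧ ∀ z ∈ K, (star F).app L z ∈ K from key.1
  induction hF using NonUnitalStarAlgebra.adjoin_induction with
  | mem F hF =>
    obtain ⟨f, hf, hF⟩ := hF
    exact h f hf _ (hF L)
  | add F F' _ _ h h' =>
    refine ⟨fun z hz => K.add_mem (h.1 z hz) (h'.1 z hz), fun z hz => ?_⟩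
    rw [star_add]
    exact K.add_mem (h.2 z hz) (h'.2 z hz)
  | zero =>
    refine ⟨fun z hz => K.zero_mem, fun z hz => ?_⟩
    rw [star_zero]
    exact K.zero_mem
  | mul F F' _ _ h h' =>
    refine ⟨fun z hz => h.1 _ (h'.1 z hz), fun z hz => ?_⟩
    rw [star_mul]
    exact h'.2 _ (h.2 z hz)
  | smul c F _ h =>
    refine ⟨fun z hz => K.smul_mem c (h.1 z hz), fun z hz => ?_⟩
    rw [star_smul]
    exact K.smul_mem _ (h.2 z hz)
  | star F _ h => exact ⟨h.2, by rw [star_star]; exact h.1⟩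

theorem isNontrivialInvariant_l2 {M : L.bundle.Subbundle} (hM : M.Nontrivial)
    (hi : L.Invariant M) : IsNontrivialInvariant L.pi M.l2 :=
  ⟨M.isClosed_l2, hM.l2_ne_bot, hM.l2_ne_top, L.pi_mem_of_forall_integrated M.isClosed_l2
    fun _ _ _ hT => hi.l2_invariant hT⟩

/-! ### From subspaces to subbundles -/

/-- Testing against C_c(G) gives vanishing ν₀-a.e., and ν ≪ ν₀ turns this into ν-a.e. -/
theorem ae_coeff_eq_zero {ξ η : L.bundle.SqInt}
    (h : ∀ f ∈ Cc G, ∀ a : CStar.{u, v} hs, L.IsIntegrated f (L.pi a) →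
      Inner.inner ℂ η.cls (L.pi a ξ.cls) = 0) :
    ∀ᵐ x ∂(hs.nu L.μ), Inner.inner ℂ (η (r x)) (L.op x (ξ (d x))) = 0 := by
  refine (HaarSystem.QuasiInvariant.nu_absolutelyContinuous_nu0 hs L.quasiInvariant).ae_le ?_
  refine ae_eq_zero_of_forall_Cc (fun f hf => ?_) fun f hf => ?_
  · obtain ⟨a, ha⟩ := exists_cstar (hs := hs) hf
    exact (ha L ξ η).1
  · obtain ⟨a, ha⟩ := exists_cstar (hs := hs) hf
    rw [← (ha L ξ η).2, h f hf a (ha L)]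

/-- Integrated representations are nondegenerate. -/
theorem cls_eq_zero_of_forall_pi {η : L.bundle.SqInt}
    (h : ∀ f ∈ Cc G, ∀ a : CStar.{u, v} hs, L.IsIntegrated f (L.pi a) →
      ∀ z, Inner.inner ℂ η.cls (L.pi a z) = 0) : η.cls = 0 := by
  obtain ⟨e, he⟩ := L.bundle.exists_sqInt_fundamental
  refine HilbertBundle.SqInt.cls_eq_iff (η := 0).2 (hs.ae_of_ae_r L.μ ?_)
  filter_upwards [ae_all_iff.2 fun n => L.ae_coeff_eq_zero (ξ := e n) fun f hf a ha =>
      h f hf a ha _,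
    L.ae_unitary] with x hx hu
  -- The functional v ↦ ⟨η(r(x)), L(x)v⟩ vanishes on a total set, hence everywhere; surjectivity of
  -- L(x) then gives η(r(x)) = 0.
  let φ : L.bundle.Fiber (d x) →L[ℂ] ℂ := (innerSL ℂ (η (r x))).comp (L.op x)
  have hφ : (⊤ : Submodule ℂ (L.bundle.Fiber (d x))) ≤ φ.ker := by
    rw [← he (d x)]
    refine Submodule.topologicalClosure_minimal _ (Submodule.span_le.2 ?_) φ.isClosed_ker
    rintro _ ⟨n, rfl⟩
    exact hx n
  obtain ⟨v, hv⟩ := hu.2.2 (η (r x))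
  have h1 : Inner.inner ℂ (η (r x)) (L.op x v) = 0 := hφ (Submodule.mem_top (x := v))
  rw [hv] at h1
  exact inner_self_eq_zero.1 h1

variable {K : Submodule ℂ L.Space}

/-- The algebra is closed under the star operation, so the adjoint of π(a) is π(a⋆), which preserves
K. -/
theorem pi_mem_orthogonal (hi : ∀ a, ∀ z ∈ K, L.pi a z ∈ K) (a : CStar.{u, v} hs) {w : L.Space}
    (hw : w ∈ Kᗮ) : L.pi a w ∈ Kᗮ := by
  refine (Submodule.mem_orthogonal _ _).2 fun z hz => ?_
  rw [← ContinuousLinearMap.adjoint_inner_left, ← ContinuousLinearMap.star_eq_adjoint, ← map_star]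
  exact (Submodule.mem_orthogonal _ _).1 hw _ (hi _ _ hz)

theorem ae_coeff_eq_zero_of_invariant (hi : ∀ a, ∀ z ∈ K, L.pi a z ∈ K) {ξ η : L.bundle.SqInt}
    (hξ : ξ.cls ∈ K) (hη : η.cls ∈ Kᗮ) :
    ∀ᵐ x ∂(hs.nu L.μ), Inner.inner ℂ (η (r x)) (L.op x (ξ (d x))) = 0 :=
  L.ae_coeff_eq_zero fun _ _ a _ => (Submodule.mem_orthogonal' _ _).1 hη _ (hi a _ hξ)

/-- Sections in an invariant subspace are pointwise orthogonal to those in its complement. -/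
theorem ae_inner_eq_zero_of_invariant (hK : IsClosed (K : Set L.Space))
    (hi : ∀ a, ∀ z ∈ K, L.pi a z ∈ K) {ξ η : L.bundle.SqInt}
    (hξ : ξ.cls ∈ K) (hη : η.cls ∈ Kᗮ) : ∀ᵐ a ∂L.μ, Inner.inner ℂ (η a) (ξ a) = 0 := by
  have := hK.completeSpace_coe
  refine HilbertBundle.SqInt.ae_inner_eq_zero fun s hs' => ?_
  obtain ⟨p, hp, q, hq, hpq⟩ := K.exists_add_mem_mem_orthogonal (η.restrict s hs').cls
  -- The restricted section 1_s η need not be known to lie in Kᗮ: its coefficients against K are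
  -- those of η multiplied by 1_s(r(x)), hence still zero.
  have hy : ∀ f ∈ Cc G, ∀ a : CStar.{u, v} hs, L.IsIntegrated f (L.pi a) → ∀ z ∈ K,
      Inner.inner ℂ (η.restrict s hs').cls (L.pi a z) = 0 := by
    intro f hf a ha z hz
    obtain ⟨ζ, rfl⟩ := SeparationQuotient.surjective_mk z
    refine ha.inner_eq_zero ?_
    filter_upwards [L.ae_coeff_eq_zero_of_invariant hi hz hη] with x hx
    by_cases hxs : r x ∈ s
    · rw [HilbertBundle.SqInt.restrict_apply_mem hs' η hxs, hx]
    · rw [HilbertBundle.SqInt.restrict_apply_notMem hs' η hxs, inner_zero_left]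
  obtain ⟨ρ, rfl⟩ := SeparationQuotient.surjective_mk p
  -- The K-component p of 1_s η is orthogonal to π_L(f)K by the previous step and to π_L(f)Kᗮ ⊆ Kᗮ,
  -- so nondegeneracy gives p = 0 and 1_s η lies in Kᗮ.
  have hp0 : SeparationQuotient.mk ρ = 0 := by
    refine L.cls_eq_zero_of_forall_pi fun f hf a ha z => ?_
    obtain ⟨z₁, hz₁, z₂, hz₂, rfl⟩ := K.exists_add_mem_mem_orthogonal z
    have h1 := hy f hf a ha z₁ hz₁
    rw [hpq, inner_add_left, (Submodule.mem_orthogonal' _ _).1 hq _ (hi a _ hz₁), add_zero] at h1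
    rw [map_add, inner_add_right, h1,
      (Submodule.mem_orthogonal _ _).1 (L.pi_mem_orthogonal hi a hz₂) _ hp, add_zero]
  rw [hpq, hp0, zero_add]
  exact (Submodule.mem_orthogonal' _ _).1 hq _ hξ

theorem reducible_of_isNontrivialInvariant (hK : IsNontrivialInvariant L.pi K) : L.Reducible := by
  obtain ⟨hcl, hbot, htop, hi⟩ := hK
  have := hcl.completeSpace_coe
  obtain ⟨e, he⟩ := L.bundle.exists_sqInt_fundamental
  have hdec : ∀ n, ∃ ξ : L.bundle.SqInt, ξ.cls ∈ K ∧ (e n - ξ).cls ∈ Kᗮ := fun n => by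
    obtain ⟨p, hp, q, hq, hpq⟩ := K.exists_add_mem_mem_orthogonal (e n).cls
    obtain ⟨ξ, rfl⟩ := SeparationQuotient.surjective_mk p
    refine ⟨ξ, hp, ?_⟩
    rwa [HilbertBundle.SqInt.cls, SeparationQuotient.mk_sub, sub_eq_iff_eq_add'.2 hpq]
  choose ξ hξ hη using hdec
  let M : L.bundle.Subbundle :=
    { space := fun a => (Submodule.span ℂ (Set.range fun n => ξ n a)).topologicalClosure
      exists_fundamental := ⟨fun n => ξ n, fun n => (ξ n).mem_meas, fun a => rfl⟩ }
  have hle : ∀ a (N : Submodule ℂ (L.bundle.Fiber a)), IsClosed (N : Set (L.bundle.Fiber a)) →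
      (∀ n, ξ n a ∈ N) → M.space a ≤ N := fun a N hN h => by
    refine Submodule.topologicalClosure_minimal _ (Submodule.span_le.2 ?_) hN
    rintro _ ⟨n, rfl⟩
    exact h n
  -- With η_n = e_n - ξ_n, this makes membership in M_a testable by countably many inner products;
  -- it serves both for M ≠ 0 and for invariance.
  have hM : ∀ᵐ a ∂L.μ, ∀ v, (∀ n, Inner.inner ℂ ((e n - ξ n) a) v = 0) → v ∈ M.space a := by
    filter_upwards [ae_all_iff.2 fun n => ae_all_iff.2 fun m =>
      L.ae_inner_eq_zero_of_invariant hcl hi (hξ m) (hη n)] with a ha v hv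
    refine mem_closure_span_of_orthogonal (η := fun n => (e n - ξ n) a) ha ?_ hv
    simpa only [HilbertBundle.SqInt.sub_apply, add_sub_cancel] using he a
  refine ⟨M, ⟨pos_iff_ne_zero.2 fun h0 => hbot ?_, pos_iff_ne_zero.2 fun h0 => htop ?_⟩, ?_⟩
  -- Any section in K is a.e. orthogonal to the η_n(a), hence lies in M_a; if M_a = 0 a.e. then K =
  -- 0.
  · refine (Submodule.eq_bot_iff _).2 fun z hz => ?_
    obtain ⟨ζ, rfl⟩ := SeparationQuotient.surjective_mk z
    refine HilbertBundle.SqInt.cls_eq_iff (η := 0).2 ?_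
    filter_upwards [hM, measure_eq_zero_iff_ae_notMem.1 h0, ae_all_iff.2 fun n =>
      L.ae_inner_eq_zero_of_invariant hcl hi hz (hη n)] with a h1 h2 h3
    have h4 := h1 _ h3
    rwa [not_not.1 h2, Submodule.mem_bot] at h4
  -- Any section in Kᗮ is a.e. orthogonal to the ξ_n(a), hence to M_a; if M_a = H_a a.e. it is
  -- orthogonal to itself and Kᗮ = 0.
  · rw [← Submodule.orthogonal_eq_bot_iff, Submodule.eq_bot_iff]
    intro w hw
    obtain ⟨η, rfl⟩ := SeparationQuotient.surjective_mk w
    refine HilbertBundle.SqInt.cls_eq_iff (η := 0).2 ?_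
    filter_upwards [measure_eq_zero_iff_ae_notMem.1 h0, ae_all_iff.2 fun n =>
      L.ae_inner_eq_zero_of_invariant hcl hi (hξ n) hw] with a h2 h3
    have h4 := hle a (ℂ ∙ η a)ᗮ (Submodule.isClosed_orthogonal _) fun n =>
      Submodule.mem_orthogonal_singleton_iff_inner_right.2 (h3 n)
    rw [not_not.1 h2] at h4
    exact inner_self_eq_zero.1
      (Submodule.mem_orthogonal_singleton_iff_inner_right.1 (h4 (Submodule.mem_top (x := η a))))
  · filter_upwards [(hs.quasiMeasurePreserving_r L.μ).ae hM, ae_all_iff.2 fun n =>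
      ae_all_iff.2 fun m => L.ae_coeff_eq_zero_of_invariant hi (hξ m) (hη n)] with x h1 h2 v hv
    refine h1 _ fun n => ?_
    -- The kernel of v ↦ ⟨η_n(r(x)), L(x)v⟩ is closed and contains every ξ_m(d(x)), so it contains
    -- M_{d(x)}.
    exact hle (d x) ((innerSL ℂ ((e n - ξ n) (r x))).comp (L.op x)).ker
      (ContinuousLinearMap.isClosed_ker _) (fun m => h2 n m) hv

end Representation

end LCGroupoid

/-- Let `μ` be an ergodic quasi-invariant measure and `L` a representation of `G` on a Hilbert bundle
over `(G⁰, μ)`. The `L²`-sections of a nontrivial invariant subbundle form a nontrivial closed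
subspace invariant under `π_L`; if `L` is reducible, then so is `π_L`; and `L` and `π_L` are
irreducible at the same time. -/
theorem theorem2p9 {G : Type u} [TopologicalSpace G] [MeasurableSpace G] [BorelSpace G]
    [LCGroupoid.LocallyCompactGroupoid G] (hs : LCGroupoid.HaarSystem G)
    (L : LCGroupoid.Representation.{u, v} hs) (hμ : hs.Ergodic L.μ) :
    (∀ M : L.bundle.Subbundle, M.Nontrivial → L.Invariant M →
        LCGroupoid.IsNontrivialInvariant L.pi M.l2) ∧
      (L.Reducible → LCGroupoid.ReducibleRep L.pi) ∧
      (L.Irreducible ↔ LCGroupoid.IrreducibleRep L.pi) := by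
  have h1 : ∀ M : L.bundle.Subbundle, M.Nontrivial → L.Invariant M →
      LCGroupoid.IsNontrivialInvariant L.pi M.l2 := fun M => L.isNontrivialInvariant_l2
  have h2 : L.Reducible → LCGroupoid.ReducibleRep L.pi := fun ⟨M, hM, hi⟩ => ⟨M.l2, h1 M hM hi⟩
  exact ⟨h1, h2, not_congr ⟨h2, fun ⟨_, hK⟩ => L.reducible_of_isNontrivialInvariant hK⟩⟩
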